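/- Conventions. A 2-complex $Y=(V,E,F)$ consists of vertices, oriented edges and oriented faces, with fixed-point-free inversions $e\mapsto e^{-1}$, $f\mapsto f^{-1}$; every face $f$ has a boundary $\partial f$, a non-empty based cyclically reduced edge loop, with $\partial(f^{-1})=(\partial f)^{-1}$. $|Y^{(1)}|$ and $|Y|$ denote the numbers of geometric edges $\{e,e^{-1}\}$ and geometric faces $\{f,f^{-1}\}$. Let $X_m=\{x_1,\dots,x_m\}$. $Y$ is *fillable* by a set $R$ of words in $X_m^{\pm}$ (or by the presentation $\langle X_m\mid R\rangle$) if there are labelings $\varphi_1:E\to X_m^{\pm}$, $\varphi_2:F\to R\cup R^{-1}$ with $\varphi_1(e^{-1})=\varphi_1(e)^{-1}$, $\varphi_2(f^{-1})=\varphi_2(f)^{-1}$ and $\varphi_1(\partial f)=\varphi_2(f)$ as words, which are reduced: no two distinct faces have the same label and a common edge at the same position of their boundaries. A *geometric form* $(Y,\lambda)$ is a finite connected 2-complex $Y$ without isolated edges (every edge lies on the boundary of a face) with lengths $\lambda_e=\lambda_{e^{-1}}\in(0,1]$ on its edges such that $\sum_{e\in\partial f}\lambda_e\le 1$ (counted with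 multiplicity) for every face $f$. For $\ell$ large enough, let $Y_\ell$ be the 2-complex obtained from $Y$ by dividing every edge $e$ into $\lfloor\lambda_e\ell\rfloor$ edges. Let $m\ge 2$ and let $B_\ell$ be the set of cyclically reduced words of length at most $\ell$ in $X_m^{\pm}$. A sequence of random groups $G_\ell(m,d)=\langle X_m\mid R_\ell\rangle$ with $m$ generators at density $d\in[0,1]$ is given by random subsets $R_\ell\subseteq B_\ell$ such that the law of each $R_\ell$ is invariant under all permutations of $B_\ell$, and $\log_{|B_\ell|}|R_\ell|$ converges to $d$ in probability (with $\log 0=-\infty$). **Statement.** Let $(G_\ell(m,d))$ be a sequence of random groups with $m\ge2$ generators at density $d$, let $(Y,\lambda)$ be a geometric form, with associated sequence $(Y_\ell)$, and let $s>0$. Suppose that, for all sufficiently large $\ell$, $Y_\ell$ is fillable by $B_\ell$ and every sub-2-complex $Z_\ell$ of $Y_\ell$ satisfies $$|Z_\ell^{(1)}|\ \ge\ (1-d+s)\,|Z_\ell|\,\ell .$$ Then asymptotically almost surely $Y_\ell$ is fillable by $G_\ell(m,d)$, i.e. $\Pr(Y_\ell\text{ is fillable by }R_\ell)\to1$ as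 $\ell\to\infty$. -/

import Mathlib

open Filter Topology MeasureTheory

/-- An oriented combinatorial 2-complex: oriented edges and oriented faces come with fixed-point-free
involutions `inv` and `finv`.  The boundary of a face is a based loop, given by its list of oriented
edges; `Cycle.Chain` expresses that cyclically consecutive edges match up and do not backtrack, i.e.
that the list is a cyclically reduced loop. -/
structure TwoComplex (V E F : Type*) where
  src : E → V
  tgt : E → V
  inv : E → E
  src_inv : ∀ e, src (inv e) = tgt e
  tgt_inv : ∀ e, tgt (inv e) = src e
  inv_inv : ∀ e, inv (inv e) = e
  inv_ne : ∀ e, inv e ≠ e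
  finv : F → F
  finv_finv : ∀ f, finv (finv f) = f
  finv_ne : ∀ f, finv f ≠ f
  bdry : F → List E
  bdry_ne_nil : ∀ f, bdry f ≠ []
  bdry_chain : ∀ f, Cycle.Chain (fun e e' => tgt e = src e' ∧ e' ≠ inv e) (bdry f : Cycle E)
  bdry_finv : ∀ f, bdry (finv f) = ((bdry f).map inv).reverse

namespace TwoComplex

variable {V E F : Type*}

/-- Any two vertices are joined by an edge path, and there is at least one vertex. -/
def IsConnected (Y : TwoComplex V E F) : Prop :=
  Nonempty V ∧ ∀ u v : V, Relation.ReflTransGen (fun a b => ∃ e, Y.src e = a ∧ Y.tgt e = b) u v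

/-- Every edge lies on the boundary of some (oriented) face. -/
def NoIsolatedEdges (Y : TwoComplex V E F) : Prop :=
  ∀ e, ∃ f, e ∈ Y.bdry f

/-- A sub-2-complex. -/
structure Sub (Y : TwoComplex V E F) where
  verts : Set V
  edges : Set E
  faces : Set F
  src_mem : ∀ e ∈ edges, Y.src e ∈ verts
  inv_mem : ∀ e ∈ edges, Y.inv e ∈ edges
  finv_mem : ∀ f ∈ faces, Y.finv f ∈ faces
  bdry_mem : ∀ f ∈ faces, ∀ e ∈ Y.bdry f, e ∈ edges

/-- The number of geometric edges (pairs of inverse edges) of a sub-2-complex. -/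
noncomputable def Sub.numEdges {Y : TwoComplex V E F} (Z : Y.Sub) : ℕ :=
  ((fun e => s(e, Y.inv e)) '' Z.edges).ncard

/-- The number of geometric faces (pairs of inverse faces) of a sub-2-complex. -/
noncomputable def Sub.numFaces {Y : TwoComplex V E F} (Z : Y.Sub) : ℕ :=
  ((fun f => s(f, Y.finv f)) '' Z.faces).ncard

/-- A van Kampen 2-complex over the presentation `⟨X | R⟩` with underlying 2-complex `Y`.
Letters of `X^±` are pairs in `X × Bool`, as for Mathlib's free groups; `FreeGroup.invRev` is the
formal inverse of a word. -/
structure VanKampen (Y : TwoComplex V E F) {X : Type*} (R : Set (List (X × Bool))) where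
  edgeLabel : E → X × Bool
  faceLabel : F → List (X × Bool)
  edgeLabel_inv : ∀ e, edgeLabel (Y.inv e) = ((edgeLabel e).1, !(edgeLabel e).2)
  faceLabel_mem : ∀ f, faceLabel f ∈ R ∨ FreeGroup.invRev (faceLabel f) ∈ R
  faceLabel_finv : ∀ f, faceLabel (Y.finv f) = FreeGroup.invRev (faceLabel f)
  compatible : ∀ f, (Y.bdry f).map edgeLabel = faceLabel f

/-- There is no reducible pair of faces, i.e. no two distinct faces with the same label and a common
edge at the same position on their boundaries. -/
def VanKampen.IsReduced {Y : TwoComplex V E F} {X : Type*} {R : Set (List (X × Bool))}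
    (D : Y.VanKampen R) : Prop :=
  ¬ ∃ f f' : F, f ≠ f' ∧ D.faceLabel f = D.faceLabel f' ∧
    ∃ (j : ℕ) (e : E), (Y.bdry f)[j]? = some e ∧ (Y.bdry f')[j]? = some e

/-- `Y` is fillable by the set of relators `R`. -/
def Fillable (Y : TwoComplex V E F) {X : Type*} (R : Set (List (X × Bool))) : Prop :=
  ∃ D : Y.VanKampen R, D.IsReduced

section Subdivision

/-- Oriented edges of the subdivision: the `i`-th segment (`0 ≤ i < n e`) of the oriented edge `e`. -/
abbrev SubdivEdge (n : E → ℕ) : Type _ := {p : E × ℕ // p.2 < n p.1}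

/-- Vertices of the subdivision: the old vertices, and one new vertex for every interior division
point, where the `i`-th division point of `e` is the `(n e - i)`-th one of the inverse of `e`. -/
abbrev SubdivVertex (Y : TwoComplex V E F) (n : E → ℕ) : Type _ :=
  V ⊕ {p : Sym2 (E × ℕ) // ∃ e i, 0 < i ∧ i < n e ∧ p = s((e, i), (Y.inv e, n e - i))}

/-- The `i`-th division point of the edge `e`, for `0 ≤ i ≤ n e`. -/
def subdivPoint (Y : TwoComplex V E F) (n : E → ℕ) (e : E) (i : ℕ) : Y.SubdivVertex n :=
  if h : 0 < i ∧ i < n e then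
    Sum.inr ⟨s((e, i), (Y.inv e, n e - i)), e, i, h.1, h.2, rfl⟩
  else if i = 0 then Sum.inl (Y.src e) else Sum.inl (Y.tgt e)

/-- The edge `e` seen as a path in the subdivision. -/
def subdivArc (n : E → ℕ) (e : E) : List (SubdivEdge n) :=
  (List.finRange (n e)).map fun i : Fin (n e) => ⟨(e, (i : ℕ)), i.2⟩

theorem subdivPoint_inv (Y : TwoComplex V E F) (n : E → ℕ) (hpos : ∀ e, 0 < n e)
    (hinv : ∀ e, n (Y.inv e) = n e) (e : E) (i : ℕ) (hi : i ≤ n e) :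
    Y.subdivPoint n (Y.inv e) (n e - i) = Y.subdivPoint n e i := by
  have h1 := hpos e
  have h2 := hinv e
  unfold subdivPoint
  by_cases h : 0 < i ∧ i < n e
  · have h' : 0 < n e - i ∧ n e - i < n (Y.inv e) := by omega
    rw [dif_pos h, dif_pos h']
    congr 1
    apply Subtype.ext
    simp only
    rw [Y.inv_inv, Sym2.eq_swap, show n (Y.inv e) - (n e - i) = i by omega]
  · have h' : ¬ (0 < n e - i ∧ n e - i < n (Y.inv e)) := by omega
    rw [dif_neg h, dif_neg h']
    by_cases h0 : i = 0
    · rw [if_pos h0, if_neg (by omega), Y.tgt_inv]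
    · rw [if_neg h0, if_pos (by omega), Y.src_inv]

theorem subdivArc_ne_nil (n : E → ℕ) (hpos : ∀ e, 0 < n e) (e : E) : subdivArc n e ≠ [] := by
  intro h
  have := congrArg List.length h
  have := hpos e
  simp [subdivArc] at *
  omega

theorem subdivArc_head (n : E → ℕ) (e : E) (x : SubdivEdge n)
    (hx : x ∈ (subdivArc n e).head?) : x.1.1 = e ∧ x.1.2 = 0 := by
  rw [subdivArc, List.head?_eq_getElem?] at hx
  simp only [List.getElem?_map, Option.mem_def, Option.map_eq_some_iff] at hx
  obtain ⟨i, hi, rfl⟩ := hx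
  rw [List.getElem?_eq_some_iff] at hi
  obtain ⟨h, rfl⟩ := hi
  simp

theorem subdivArc_last (n : E → ℕ) (e : E) (x : SubdivEdge n)
    (hx : x ∈ (subdivArc n e).getLast?) : x.1.1 = e ∧ x.1.2 + 1 = n e := by
  rw [subdivArc, List.getLast?_eq_getElem?] at hx
  simp only [List.getElem?_map, Option.mem_def, Option.map_eq_some_iff] at hx
  obtain ⟨i, hi, rfl⟩ := hx
  rw [List.getElem?_eq_some_iff] at hi
  obtain ⟨h, rfl⟩ := hi
  simp only [List.length_map, List.length_finRange] at h
  simp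
  omega

/-- The boundary paths stay cyclically reduced loops after subdivision. -/
theorem subdiv_chain (Y : TwoComplex V E F) (n : E → ℕ) (hpos : ∀ e, 0 < n e)
    (r : SubdivEdge n → SubdivEdge n → Prop)
    (hr₁ : ∀ x y : SubdivEdge n, x.1.1 = y.1.1 → x.1.2 + 1 = y.1.2 → r x y)
    (hr₂ : ∀ x y : SubdivEdge n, x.1.2 + 1 = n x.1.1 → y.1.2 = 0 →
      Y.tgt x.1.1 = Y.src y.1.1 ∧ y.1.1 ≠ Y.inv x.1.1 → r x y) (f : F) :
    Cycle.Chain r ((Y.bdry f).flatMap (subdivArc n) : Cycle (SubdivEdge n)) := by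
  have key : ∀ l : List E, l.IsChain (fun e e' => Y.tgt e = Y.src e' ∧ e' ≠ Y.inv e) →
      (l.flatMap (subdivArc n)).IsChain r := by
    intro l hl
    rw [List.flatMap, List.isChain_flatten]
    · refine ⟨?_, ?_⟩
      · intro a ha
        obtain ⟨e, -, rfl⟩ := List.mem_map.1 ha
        rw [List.isChain_iff_getElem]
        intro i hi
        apply hr₁ <;> simp [subdivArc]
      · rw [List.isChain_map]
        refine hl.imp ?_
        intro e e' h x hx y hy
        obtain ⟨hx1, hx2⟩ := subdivArc_last n e x hx
        obtain ⟨hy1, hy2⟩ := subdivArc_head n e' y hy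
        exact hr₂ x y (by rw [hx2, hx1]) hy2 (by rw [hx1, hy1]; exact h)
    · intro h
      obtain ⟨e, -, he⟩ := List.mem_map.1 h
      exact subdivArc_ne_nil n hpos e he
  have hc := Y.bdry_chain f
  rcases hb : Y.bdry f with _ | ⟨a, l⟩
  · exact absurd hb (Y.bdry_ne_nil f)
  · rw [hb, Cycle.chain_coe_cons] at hc
    have h := key _ hc
    rcases ha : subdivArc n a with _ | ⟨x, t⟩
    · exact absurd ha (subdivArc_ne_nil n hpos a)
    · simp only [List.flatMap_cons, List.flatMap_append, List.flatMap_nil, ha,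
        List.append_nil, List.cons_append] at h ⊢
      rw [Cycle.chain_coe_cons]
      refine List.IsChain.prefix h ⟨t, ?_⟩
      simp

theorem subdivArc_inv (Y : TwoComplex V E F) (n : E → ℕ)
    (hinv : ∀ e, n (Y.inv e) = n e) (i : SubdivEdge n → SubdivEdge n)
    (hi : ∀ p, (i p).1 = (Y.inv p.1.1, n p.1.1 - 1 - p.1.2)) (e : E) :
    subdivArc n (Y.inv e) = ((subdivArc n e).map i).reverse := by
  apply List.ext_getElem
  · simp [subdivArc, hinv]
  · intro j h1 h2
    apply Subtype.ext
    simp only [subdivArc, List.length_map, List.length_finRange, hinv] at h1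
    simp [subdivArc, hi]
    omega

/-- The 2-complex obtained from `Y` by dividing every edge `e` into `n e ≥ 1` edges. -/
def subdivide (Y : TwoComplex V E F) (n : E → ℕ) (hpos : ∀ e, 0 < n e)
    (hinv : ∀ e, n (Y.inv e) = n e) : TwoComplex (Y.SubdivVertex n) (SubdivEdge n) F where
  src p := Y.subdivPoint n p.1.1 p.1.2
  tgt p := Y.subdivPoint n p.1.1 (p.1.2 + 1)
  inv p := ⟨(Y.inv p.1.1, n p.1.1 - 1 - p.1.2), by
    have := p.2; have := hinv p.1.1; simp only; omega⟩
  src_inv p := by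
    have := Y.subdivPoint_inv n hpos hinv p.1.1 (p.1.2 + 1) p.2
    simp only
    rw [← this, Nat.sub_sub, Nat.add_comm]
  tgt_inv p := by
    have h2 := p.2
    have := Y.subdivPoint_inv n hpos hinv p.1.1 p.1.2 p.2.le
    simp only
    rw [← this]
    congr 1
    omega
  inv_inv p := by
    have h2 := p.2
    have := hinv p.1.1
    apply Subtype.ext
    simp only [Y.inv_inv, this]
    apply Prod.ext <;> simp only
    omega
  inv_ne p h := Y.inv_ne p.1.1 (congrArg (fun q : SubdivEdge n => q.1.1) h)
  finv := Y.finv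
  finv_finv := Y.finv_finv
  finv_ne := Y.finv_ne
  bdry f := (Y.bdry f).flatMap (subdivArc n)
  bdry_ne_nil f h := by
    obtain ⟨e, he⟩ := List.exists_mem_of_ne_nil _ (Y.bdry_ne_nil f)
    exact subdivArc_ne_nil n hpos e (List.flatMap_eq_nil_iff.1 h e he)
  bdry_chain f := by
    refine Y.subdiv_chain n hpos _ ?_ ?_ f
    · intro x y h1 h2
      refine ⟨by rw [h1, h2], fun h => Y.inv_ne x.1.1 ?_⟩
      exact (congrArg (fun q : SubdivEdge n => q.1.1) h).symm.trans h1.symm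
    · intro x y h1 h2 h
      refine ⟨?_, fun h' => h.2 (congrArg (fun q : SubdivEdge n => q.1.1) h')⟩
      have := hpos x.1.1
      simp only [subdivPoint]
      rw [dif_neg (by omega), dif_neg (by omega), if_neg (by omega), if_pos h2, h.1]
  bdry_finv f := by
    rw [Y.bdry_finv, List.map_flatMap, List.reverse_flatMap, ← List.map_reverse,
      List.flatMap_map]
    congr 1
    funext e
    exact Y.subdivArc_inv n hinv _ (fun _ => rfl) e

end Subdivision

end TwoComplex

/-- A geometric form: a finite connected 2-complex without isolated edges, with a length in `(0, 1]`
on every geometric edge, such that every face has boundary length at most `1`. -/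
structure GeometricForm (V E F : Type*) extends TwoComplex V E F where
  finite_verts : Finite V
  finite_edges : Finite E
  finite_faces : Finite F
  connected : toTwoComplex.IsConnected
  noIsolatedEdges : toTwoComplex.NoIsolatedEdges
  len : E → ℝ
  len_inv : ∀ e, len (inv e) = len e
  len_pos : ∀ e, 0 < len e
  len_le_one : ∀ e, len e ≤ 1
  bdry_len_le_one : ∀ f, ((bdry f).map len).sum ≤ 1

/-- The 2-complex `Y_ℓ`: every edge `e` of `Y` is divided into `⌊λ_e ℓ⌋` edges.  The maximum with `1`
only matters for the finitely many `ℓ` with some `⌊λ_e ℓ⌋ = 0`, where the division makes no sense. -/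
noncomputable def GeometricForm.scaled {V E F : Type*} (Y : GeometricForm V E F) (ℓ : ℕ) :
    TwoComplex (Y.toTwoComplex.SubdivVertex fun e => max 1 ⌊Y.len e * ℓ⌋₊)
      (TwoComplex.SubdivEdge fun e : E => max 1 ⌊Y.len e * ℓ⌋₊) F :=
  Y.toTwoComplex.subdivide (fun e => max 1 ⌊Y.len e * ℓ⌋₊)
    (fun _ => lt_of_lt_of_le Nat.one_pos (le_max_left _ _))
    (fun e => by simp only [Y.len_inv])

/-- `B_ℓ`: the cyclically reduced words of length at most `ℓ` in the letters `x_1^±, …, x_m^±`. -/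
def relatorBall (m ℓ : ℕ) : Set (List (Fin m × Bool)) :=
  {w | FreeGroup.IsCyclicallyReduced w ∧ w.length ≤ ℓ}

/-- A permutation invariant random subset `R` of a (finite) set `B`. -/
structure IsPermInvariantRandomSubset {A : Type*} (B : Set A) {Ω : Type*} [MeasurableSpace Ω]
    (P : Measure Ω) (R : Ω → Set B) : Prop where
  measurableSet_eq : ∀ S : Set B, MeasurableSet {ω | R ω = S}
  perm_invariant : ∀ (σ : Equiv.Perm B) (S : Set B), P {ω | R ω = S} = P {ω | R ω = σ '' S}

/-- The sequence of random subsets `R_ℓ` of `B_ℓ` is densable with density `d`: the random variables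
`log_{|B_ℓ|} |R_ℓ|` (with value `-∞` where `R_ℓ` is empty) converge to `d` in probability. -/
def IsDensable {A : Type*} (B : ℕ → Set A) {Ω : ℕ → Type*} [∀ ℓ, MeasurableSpace (Ω ℓ)]
    (P : ∀ ℓ, Measure (Ω ℓ)) (R : ∀ ℓ, Ω ℓ → Set (B ℓ)) (d : ℝ) : Prop :=
  ∀ ε : ℝ, 0 < ε → Tendsto (fun ℓ => P ℓ {ω | (R ℓ ω).Nonempty ∧
    |Real.logb ((B ℓ).ncard : ℝ) ((R ℓ ω).ncard : ℝ) - d| ≤ ε}) atTop (𝓝 1)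

/-- `R_ℓ` is the random set of relators of a sequence of random groups `G_ℓ(m, d) = ⟨X_m | R_ℓ⟩`
with `m` generators at density `d`. -/
structure IsRandomGroupSequence (m : ℕ) (d : ℝ) {Ω : ℕ → Type*} [∀ ℓ, MeasurableSpace (Ω ℓ)]
    (P : ∀ ℓ, Measure (Ω ℓ)) (R : ∀ ℓ, Ω ℓ → Set (relatorBall m ℓ)) : Prop where
  permInvariant : ∀ ℓ, IsPermInvariantRandomSubset (relatorBall m ℓ) (P ℓ) (R ℓ)
  densable : IsDensable (relatorBall m) P R d

/-!
Second moment method, applied to the fillings of the subdivision by the whole ball `B`. Permutation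
invariance reduces the claim to a uniformly random set of `r` relators, with `r ≈ |B| ^ d`.

Start from one filling by `B`. Each subdivided edge `e` may be relabeled, independently of the
others, by any reduced word with the same length `n e` and the same first and last letters: the
boundary words of the faces stay cyclically reduced. The new words are drawn from a prefix-free
codebook, still of size `≈ (2m - 1) ^ n e`, so that a boundary word determines the boundary path;
since the original filling is reduced, distinct faces have distinct boundary paths, hence distinct
labels.

Prescribing the labels of a set of `t ≥ 1` faces prescribes the words on all edges of the
subcomplex `Z` they span, which leaves a proportion `≈ (2m - 1) ^ (-|Z^(1)|)` of the fillings. On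
the other hand, sharing `t` relators raises the probability that two fillings both use only
relators of the random set by a factor `≈ (|B| / r) ^ t ≈ (2m - 1) ^ ((1 - d) t ℓ)`. By the
hypothesis on `|Z^(1)|` the product is at most `(2m - 1) ^ (-s t ℓ)`, up to constants and an
arbitrarily small loss in `s`. There are boundedly many ways for the faces of two fillings to share
labels, so the second moment is asymptotic to the square of the first.
-/

section SupersetRatio

/-- The proportion, among the `r`-subsets of a `b`-set, of those containing a given `j`-subset, as
the product `(r / b) * ((r - 1) / (b - 1)) * ⋯` with `j` factors. -/
noncomputable def supersetRatio (b r j : ℕ) : ℝ :=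
  ∏ t ∈ Finset.range j, ((r : ℝ) - t) / ((b : ℝ) - t)

theorem choose_sub_sub_eq_mul_supersetRatio {b r j : ℕ} (hj : j ≤ r) (hr : r ≤ b) :
    ((b - j).choose (r - j) : ℝ) = b.choose r * supersetRatio b r j := by
  induction j with
  | zero => simp [supersetRatio]
  | succ j ih =>
    have hb : (0 : ℝ) < (b : ℝ) - j := sub_pos.2 (by exact_mod_cast (by omega : j < b))
    have hstep : ((b : ℝ) - j) * (b - (j + 1)).choose (r - (j + 1))
        = (b - j).choose (r - j) * ((r : ℝ) - j) := by
      have h := Nat.add_one_mul_choose_eq (b - (j + 1)) (r - (j + 1))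
      rw [show b - (j + 1) + 1 = b - j by omega, show r - (j + 1) + 1 = r - j by omega] at h
      rw [← Nat.cast_sub (by omega), ← Nat.cast_sub (by omega)]
      exact_mod_cast h
    rw [supersetRatio, Finset.prod_range_succ, ← mul_assoc, ← supersetRatio, ← ih (by omega),
      mul_div_assoc', eq_div_iff hb.ne', mul_comm, hstep]

theorem sub_div_sub_le_sub_div_sub {b r s t : ℝ} (hrb : r ≤ b) (hst : s ≤ t) (htb : t < b) :
    (r - t) / (b - t) ≤ (r - s) / (b - s) := by
  rw [div_le_div_iff₀ (by linarith) (by linarith)]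
  nlinarith

variable {b r k : ℕ}

theorem supersetRatio_pos (hr : r ≤ b) {j : ℕ} (hj : j ≤ r) : 0 < supersetRatio b r j := by
  refine Finset.prod_pos fun t ht => ?_
  have htr : (t : ℝ) < r := by exact_mod_cast (Finset.mem_range.1 ht).trans_le hj
  have hrb : (r : ℝ) ≤ b := by exact_mod_cast hr
  exact div_pos (by linarith) (by linarith)

theorem supersetRatio_add_le {i j : ℕ} (hr : r ≤ b) (hij : i + j ≤ r) :
    supersetRatio b r (i + j) ≤ supersetRatio b r i * supersetRatio b r j := by
  have hrb : (r : ℝ) ≤ b := by exact_mod_cast hr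
  have hi := supersetRatio_pos hr (show i ≤ r by omega)
  rw [supersetRatio, Finset.prod_range_add, ← supersetRatio]
  refine mul_le_mul_of_nonneg_left (Finset.prod_le_prod (fun t ht => ?_) fun t ht => ?_) hi.le
  all_goals
    have htr : ((i + t : ℕ) : ℝ) < r := by
      exact_mod_cast (by have := Finset.mem_range.1 ht; omega : i + t < r)
  · exact div_nonneg (by linarith) (by linarith)
  · exact sub_div_sub_le_sub_div_sub hrb (by simp) (by linarith)

theorem supersetRatio_le_pow (hr : r ≤ b) {j : ℕ} (hj : j ≤ r) :
    supersetRatio b r j ≤ ((r : ℝ) / b) ^ j := by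
  have hrb : (r : ℝ) ≤ b := by exact_mod_cast hr
  rw [← Finset.card_range j, ← Finset.prod_const, Finset.card_range]
  refine Finset.prod_le_prod (fun t ht => ?_) fun t ht => ?_
  all_goals have htr : (t : ℝ) < r := by exact_mod_cast (Finset.mem_range.1 ht).trans_le hj
  · exact div_nonneg (by linarith) (by linarith)
  · simpa using sub_div_sub_le_sub_div_sub hrb t.cast_nonneg (by linarith)

theorem pow_le_supersetRatio (hr : r ≤ b) (hk : 2 * k ≤ r) :
    ((r : ℝ) / b / 2) ^ k ≤ supersetRatio b r k := by
  have hrb : (r : ℝ) ≤ b := by exact_mod_cast hr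
  have hkr : (2 * k : ℝ) ≤ r := by exact_mod_cast hk
  rw [← Finset.card_range k, ← Finset.prod_const, Finset.card_range]
  refine Finset.prod_le_prod (fun _ _ => by positivity) fun t ht => ?_
  have htk : (t : ℝ) < k := by exact_mod_cast Finset.mem_range.1 ht
  have : (0 : ℝ) ≤ t := t.cast_nonneg
  rw [div_right_comm]
  exact div_le_div₀ (by linarith) (by linarith) (by linarith) (by linarith)

theorem supersetRatio_two_mul_sub_le (hr₀ : 0 < r) (hr : r ≤ b) (hk : 2 * k ≤ r) {i : ℕ}
    (hi : i ≤ 2 * k) :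
    supersetRatio b r (2 * k - i) ≤ 4 ^ k * ((b : ℝ) / r) ^ i * supersetRatio b r k ^ 2 := by
  have : (0 : ℝ) < r := by exact_mod_cast hr₀
  have : (0 : ℝ) < b := by exact_mod_cast hr₀.trans_le hr
  have hpow : ((r : ℝ) / b) ^ (2 * k - i) = ((b : ℝ) / r) ^ i * ((r : ℝ) / b) ^ (2 * k) := by
    rw [pow_sub₀ _ (by positivity) hi, ← inv_pow, inv_div, mul_comm]
  calc supersetRatio b r (2 * k - i) ≤ ((r : ℝ) / b) ^ (2 * k - i) :=
        supersetRatio_le_pow hr (by omega)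
    _ = 4 ^ k * ((b : ℝ) / r) ^ i * (((r : ℝ) / b / 2) ^ k) ^ 2 := by
        have h4 : (4 : ℝ) ^ k = 2 ^ (2 * k) := by rw [pow_mul]; norm_num
        rw [hpow, h4, ← pow_mul, mul_comm k, div_pow _ (2 : ℝ)]
        field_simp
    _ ≤ 4 ^ k * ((b : ℝ) / r) ^ i * supersetRatio b r k ^ 2 := by
        gcongr
        exact pow_le_supersetRatio hr hk

end SupersetRatio

section SecondMoment

variable {B ι : Type*}

theorem sq_sum_le_card_filter_ne_zero_mul (s : Finset ι) (f : ι → ℝ) :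
    (∑ i ∈ s, f i) ^ 2 ≤ (s.filter fun i => f i ≠ 0).card * ∑ i ∈ s, f i ^ 2 := by
  rw [← Finset.sum_filter_ne_zero]
  refine sq_sum_le_card_mul_sum_sq.trans (mul_le_mul_of_nonneg_left ?_ (Nat.cast_nonneg _))
  exact Finset.sum_le_sum_of_subset_of_nonneg (Finset.filter_subset _ _) fun _ _ _ => sq_nonneg _

theorem sum_le_sum_card_filter_mul {κ : Type*} {s : Finset ι} {J : Finset κ} {M : κ → ι → Prop}
    [∀ j, DecidablePred (M j)] {f : ι → ℝ} {g : κ → ℝ} (hg : ∀ j ∈ J, 0 ≤ g j)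
    (h : ∀ i ∈ s, ∃ j ∈ J, M j i ∧ f i ≤ g j) :
    ∑ i ∈ s, f i ≤ ∑ j ∈ J, (s.filter (M j)).card * g j := by
  have hpoint (i : ι) (hi : i ∈ s) : f i ≤ ∑ j ∈ J, if M j i then g j else 0 := by
    obtain ⟨j, hj, hM, hfg⟩ := h i hi
    rw [← if_pos (t := g j) (e := 0) hM] at hfg
    refine hfg.trans
      (Finset.single_le_sum (f := fun j => if M j i then g j else 0) (fun j hj => ?_) hj)
    split_ifs
    exacts [hg j hj, le_rfl]
  refine (Finset.sum_le_sum hpoint).trans_eq ?_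
  rw [Finset.sum_comm]
  exact Finset.sum_congr rfl fun j _ => by rw [← Finset.sum_filter, Finset.sum_const, nsmul_eq_mul]

variable [Fintype B] [DecidableEq B]

theorem card_filter_superset {T : Finset B} {r : ℕ} (hT : T.card ≤ r) (hr : r ≤ Fintype.card B) :
    (((Finset.powersetCard r Finset.univ).filter fun S => T ⊆ S).card : ℝ)
      = (Fintype.card B).choose r * supersetRatio (Fintype.card B) r T.card := by
  rw [Finset.card_filter_powersetCard_subset _ _ _ T.subset_univ hT, Finset.card_univ,
    choose_sub_sub_eq_mul_supersetRatio hT hr]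

theorem sum_card_filter_subset {r : ℕ} (hr : r ≤ Fintype.card B) {Φ : Finset ι}
    {W : ι → Finset B} (hW : ∀ φ ∈ Φ, (W φ).card ≤ r) :
    ∑ S ∈ Finset.powersetCard r Finset.univ, ((Φ.filter fun φ => W φ ⊆ S).card : ℝ)
      = ∑ φ ∈ Φ, (Fintype.card B).choose r * supersetRatio (Fintype.card B) r (W φ).card := by
  rw [← Finset.sum_congr rfl fun φ hφ => card_filter_superset (hW φ hφ) hr]
  exact_mod_cast (Finset.sum_card_bipartiteAbove_eq_sum_card_bipartiteBelow fun φ S => W φ ⊆ S).symm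

theorem sum_supersetRatio_union_le {k r : ℕ} (hr₀ : 0 < r) (hk : 2 * k ≤ r)
    (hr : r ≤ Fintype.card B) {Φ : Finset ι} {W : ι → Finset B} (hW : ∀ φ ∈ Φ, (W φ).card = k)
    {U : Finset B} (hU : U.card = k) {η : ℝ}
    (hη : ∑ φ ∈ Φ with (W φ ∩ U).Nonempty, ((Fintype.card B : ℝ) / r) ^ (W φ ∩ U).card
      ≤ η * Φ.card) :
    ∑ φ ∈ Φ, supersetRatio (Fintype.card B) r (W φ ∪ U).card
      ≤ supersetRatio (Fintype.card B) r k ^ 2 * ((1 + 4 ^ k * η) * Φ.card) := by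
  set b := Fintype.card B
  have hpair (φ : ι) (hφ : φ ∈ Φ) : supersetRatio b r (W φ ∪ U).card ≤
      supersetRatio b r k ^ 2 *
        (1 + 4 ^ k * if (W φ ∩ U).Nonempty then ((b : ℝ) / r) ^ (W φ ∩ U).card else 0) := by
    have hcard := Finset.card_union_add_card_inter (W φ) U
    rw [hW φ hφ, hU, ← two_mul] at hcard
    rw [show (W φ ∪ U).card = 2 * k - (W φ ∩ U).card by omega]
    split_ifs with hdisj
    · refine (supersetRatio_two_mul_sub_le hr₀ hr hk (by omega)).trans ?_
      nlinarith [sq_nonneg (supersetRatio b r k)]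
    · rw [Finset.not_nonempty_iff_eq_empty.1 hdisj, Finset.card_empty, Nat.sub_zero, two_mul,
        mul_zero, add_zero, mul_one, sq]
      exact supersetRatio_add_le hr (by omega)
  refine (Finset.sum_le_sum hpair).trans ?_
  rw [← Finset.mul_sum, Finset.sum_add_distrib, ← Finset.mul_sum, ← Finset.sum_filter,
    Finset.sum_const, nsmul_eq_mul, mul_one, add_mul, one_mul, mul_assoc (4 ^ k)]
  gcongr

theorem sum_sq_card_filter_subset_le {k r : ℕ} (hr₀ : 0 < r) (hk : 2 * k ≤ r)
    (hr : r ≤ Fintype.card B) {Φ : Finset ι} {W : ι → Finset B} (hW : ∀ φ ∈ Φ, (W φ).card = k)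
    {η : ℝ} (hη : ∀ ψ ∈ Φ, ∑ φ ∈ Φ with (W φ ∩ W ψ).Nonempty,
      ((Fintype.card B : ℝ) / r) ^ (W φ ∩ W ψ).card ≤ η * Φ.card) :
    ∑ S ∈ Finset.powersetCard r Finset.univ, ((Φ.filter fun φ => W φ ⊆ S).card : ℝ) ^ 2
      ≤ (Fintype.card B).choose r * supersetRatio (Fintype.card B) r k ^ 2 *
        (1 + 4 ^ k * η) * Φ.card ^ 2 := by
  set b := Fintype.card B
  set p := supersetRatio b r
  have hpairs (S : Finset B) : ((Φ.filter fun φ => W φ ⊆ S).card : ℝ) ^ 2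
      = ((Φ ×ˢ Φ).filter fun x => W x.2 ∪ W x.1 ⊆ S).card := by
    simp only [Finset.union_subset_iff, and_comm, sq]
    rw [Finset.filter_product (fun φ => W φ ⊆ S) (fun φ => W φ ⊆ S), Finset.card_product,
      Nat.cast_mul]
  have hunion : ∀ x ∈ Φ ×ˢ Φ, (W x.2 ∪ W x.1).card ≤ r := fun x hx => by
    obtain ⟨h₁, h₂⟩ := Finset.mem_product.1 hx
    have := Finset.card_union_le (W x.2) (W x.1)
    rw [hW _ h₁, hW _ h₂] at this
    omega
  simp only [hpairs]
  rw [sum_card_filter_subset hr hunion, ← Finset.mul_sum, Finset.sum_product]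
  calc (b.choose r : ℝ) * ∑ ψ ∈ Φ, ∑ φ ∈ Φ, p (W φ ∪ W ψ).card
      ≤ b.choose r * (Φ.card • (p k ^ 2 * ((1 + 4 ^ k * η) * Φ.card))) := by
        gcongr
        exact Finset.sum_le_card_nsmul _ _ _ fun ψ hψ =>
          sum_supersetRatio_union_le hr₀ hk hr hW (hW ψ hψ) (hη ψ hψ)
    _ = b.choose r * p k ^ 2 * (1 + 4 ^ k * η) * Φ.card ^ 2 := by rw [nsmul_eq_mul]; ring

theorem choose_le_mul_card_filter_exists_subset {k r : ℕ} (hr₀ : 0 < r) (hk : 2 * k ≤ r)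
    (hr : r ≤ Fintype.card B) {Φ : Finset ι} (hΦ : Φ.Nonempty) {W : ι → Finset B}
    (hW : ∀ φ ∈ Φ, (W φ).card = k) {η : ℝ}
    (hη : ∀ ψ ∈ Φ, ∑ φ ∈ Φ with (W φ ∩ W ψ).Nonempty,
      ((Fintype.card B : ℝ) / r) ^ (W φ ∩ W ψ).card ≤ η * Φ.card) :
    ((Fintype.card B).choose r : ℝ) ≤ (1 + 4 ^ k * η) *
      ((Finset.powersetCard r Finset.univ).filter fun S => ∃ φ ∈ Φ, W φ ⊆ S).card := by
  set b := Fintype.card B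
  set p := supersetRatio b r
  set 𝒮 := Finset.powersetCard r (Finset.univ : Finset B)
  let N (S : Finset B) : ℝ := (Φ.filter fun φ => W φ ⊆ S).card
  have hfirst : ∑ S ∈ 𝒮, N S = Φ.card * (b.choose r * p k) := by
    rw [sum_card_filter_subset hr fun φ hφ => by rw [hW φ hφ]; omega,
      Finset.sum_congr rfl fun φ hφ => by rw [hW φ hφ], Finset.sum_const, nsmul_eq_mul]
  have hhit : (𝒮.filter fun S => N S ≠ 0) = 𝒮.filter fun S => ∃ φ ∈ Φ, W φ ⊆ S := by
    simp only [N, Nat.cast_ne_zero, Finset.card_ne_zero, Finset.filter_nonempty_iff]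
  have hpos : 0 < b.choose r * p k ^ 2 * (Φ.card : ℝ) ^ 2 := by
    have hC : (0 : ℝ) < b.choose r := Nat.cast_pos.2 (Nat.choose_pos hr)
    have hp : 0 < p k := supersetRatio_pos hr (by omega)
    have : (0 : ℝ) < Φ.card := by exact_mod_cast hΦ.card_pos
    positivity
  have hcs := (sq_sum_le_card_filter_ne_zero_mul 𝒮 N).trans
    (mul_le_mul_of_nonneg_left (sum_sq_card_filter_subset_le hr₀ hk hr hW hη) (Nat.cast_nonneg _))
  rw [hfirst, hhit] at hcs
  refine le_of_mul_le_mul_left ?_ hpos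
  linarith

end SecondMoment

section RandomSubsets

namespace IsPermInvariantRandomSubset

variable {A Ω : Type*} {B : Set A} [MeasurableSpace Ω] {P : Measure Ω} {R : Ω → Set B}

theorem measure_eq_of_card_eq [Finite B] (hR : IsPermInvariantRandomSubset B P R) {S T : Finset B}
    (h : S.card = T.card) : P {ω | R ω = (S : Set B)} = P {ω | R ω = (T : Set B)} := by
  classical
  obtain ⟨σ, hσ⟩ : ∃ σ : Equiv.Perm B, S.map σ.toEmbedding = T := by
    let e : S ≃ T := Finset.equivOfCardEq h
    refine ⟨e.extendSubtype, Finset.eq_of_subset_of_card_le (fun y hy => ?_) (by simp [h])⟩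
    obtain ⟨x, hx, rfl⟩ := Finset.mem_map.1 hy
    exact e.extendSubtype_mem x hx
  rw [hR.perm_invariant σ S, ← hσ, Finset.coe_map, Equiv.coe_toEmbedding]

variable [Fintype B]

open Classical in
theorem measure_mem_eq_sum (hR : IsPermInvariantRandomSubset B P R) (𝒜 : Set (Set B)) :
    P {ω | R ω ∈ 𝒜} = ∑ S ∈ (Finset.univ : Finset (Finset B)) with ↑S ∈ 𝒜,
      P {ω | R ω = (S : Set B)} := by
  have hfiber (S : Finset B) :
      (fun ω => (R ω).toFinset) ⁻¹' {S} = {ω | R ω = (S : Set B)} := by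
    ext ω
    simp [← Finset.coe_inj]
  rw [← Finset.sum_congr rfl fun S _ => congrArg P (hfiber S),
    sum_measure_preimage_singleton _ fun S _ => hfiber S ▸ hR.measurableSet_eq S]
  congr 1
  ext ω
  simp

open Classical in
theorem ofReal_mul_sum_powersetCard_le (hR : IsPermInvariantRandomSubset B P R) {𝒜 : Set (Set B)}
    {c : ℝ} {r : ℕ} (h : c * (Fintype.card B).choose r ≤
      ((Finset.powersetCard r Finset.univ).filter fun S : Finset B => (S : Set B) ∈ 𝒜).card) :
    ENNReal.ofReal c *
        ∑ S ∈ Finset.powersetCard r (Finset.univ : Finset B), P {ω | R ω = (S : Set B)} ≤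
      ∑ S ∈ Finset.powersetCard r (Finset.univ : Finset B) with ↑S ∈ 𝒜,
        P {ω | R ω = (S : Set B)} := by
  rcases (Finset.powersetCard r (Finset.univ : Finset B)).eq_empty_or_nonempty with h₀ | ⟨T, hT⟩
  · simp [h₀]
  have hconst : ∀ S ∈ Finset.powersetCard r (Finset.univ : Finset B),
      P {ω | R ω = (S : Set B)} = P {ω | R ω = (T : Set B)} := fun S hS =>
    hR.measure_eq_of_card_eq <| by rw [Finset.mem_powersetCard_univ.1 hS,
      Finset.mem_powersetCard_univ.1 hT]
  rw [Finset.sum_congr rfl hconst,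
    Finset.sum_congr rfl fun S hS => hconst S (Finset.filter_subset _ _ hS)]
  simp only [Finset.sum_const, nsmul_eq_mul, Finset.card_powersetCard, Finset.card_univ]
  rw [← mul_assoc, ← ENNReal.ofReal_natCast, ← ENNReal.ofReal_mul' (Nat.cast_nonneg _),
    ← ENNReal.ofReal_natCast]
  gcongr

open Classical in
theorem ofReal_mul_measure_ncard_mem_le (hR : IsPermInvariantRandomSubset B P R)
    {𝒜 : Set (Set B)} {G : Set ℕ} {c : ℝ}
    (h : ∀ r ∈ G, r ≤ Fintype.card B → c * (Fintype.card B).choose r ≤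
      ((Finset.powersetCard r Finset.univ).filter fun S : Finset B => (S : Set B) ∈ 𝒜).card) :
    ENNReal.ofReal c * P {ω | (R ω).ncard ∈ G} ≤ P {ω | R ω ∈ 𝒜} := by
  have hslices (𝒢 : Set (Set B)) : P {ω | R ω ∈ 𝒢} =
      ∑ r ∈ Finset.range (Fintype.card B + 1),
        ∑ S ∈ Finset.powersetCard r (Finset.univ : Finset B) with ↑S ∈ 𝒢,
          P {ω | R ω = (S : Set B)} := by
    rw [hR.measure_mem_eq_sum, ← Finset.sum_fiberwise_of_maps_to (g := Finset.card)
      (t := Finset.range (Fintype.card B + 1))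
      fun S _ => Finset.mem_range.2 (Nat.lt_succ_of_le S.card_le_univ)]
    refine Finset.sum_congr rfl fun r _ => Finset.sum_congr ?_ fun _ _ => rfl
    ext S
    simp [and_comm]
  calc ENNReal.ofReal c * P {ω | R ω ∈ {S : Set B | S.ncard ∈ G}}
      = ∑ r ∈ Finset.range (Fintype.card B + 1), ENNReal.ofReal c *
          ∑ S ∈ Finset.powersetCard r (Finset.univ : Finset B) with S.card ∈ G,
            P {ω | R ω = (S : Set B)} := by
        rw [hslices, Finset.mul_sum]
        simp only [Set.mem_ofPred_eq, Set.ncard_coe_finset]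
    _ ≤ P {ω | R ω ∈ 𝒜} := by
        rw [hslices]
        refine Finset.sum_le_sum fun r hr => ?_
        rw [Finset.filter_congr (q := fun _ => r ∈ G) fun S hS => by
          rw [Finset.mem_powersetCard_univ.1 hS], Finset.filter_const]
        split_ifs with hrG
        · exact hR.ofReal_mul_sum_powersetCard_le
            (h r hrG (Nat.le_of_lt_succ (Finset.mem_range.1 hr)))
        · simp

end IsPermInvariantRandomSubset

open Classical in
theorem IsDensable.tendsto_measure_mem {A : Type*} {B : ℕ → Set A} [∀ ℓ, Fintype (B ℓ)]
    {Ω : ℕ → Type*} [∀ ℓ, MeasurableSpace (Ω ℓ)] {P : ∀ ℓ, Measure (Ω ℓ)}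
    [∀ ℓ, IsProbabilityMeasure (P ℓ)] {R : ∀ ℓ, Ω ℓ → Set (B ℓ)} {d ε : ℝ}
    (hdens : IsDensable B P R d) (hperm : ∀ ℓ, IsPermInvariantRandomSubset (B ℓ) (P ℓ) (R ℓ))
    (hε : 0 < ε) {𝒜 : ∀ ℓ, Set (Set (B ℓ))} {c : ℕ → ℝ} (hc : Tendsto c atTop (𝓝 1))
    (h : ∀ᶠ ℓ in atTop, ∀ r : ℕ, 0 < r → r ≤ Fintype.card (B ℓ) →
      |Real.logb (Fintype.card (B ℓ)) r - d| ≤ ε →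
      c ℓ * (Fintype.card (B ℓ)).choose r ≤ ((Finset.powersetCard r Finset.univ).filter
        fun S : Finset (B ℓ) => (S : Set (B ℓ)) ∈ 𝒜 ℓ).card) :
    Tendsto (fun ℓ => P ℓ {ω | R ℓ ω ∈ 𝒜 ℓ}) atTop (𝓝 1) := by
  have hlower : Tendsto (fun ℓ => ENNReal.ofReal (c ℓ) * P ℓ {ω | (R ℓ ω).Nonempty ∧
      |Real.logb (B ℓ).ncard (R ℓ ω).ncard - d| ≤ ε}) atTop (𝓝 1) := by
    simpa using ENNReal.Tendsto.mul (ENNReal.tendsto_ofReal hc) (by simp) (hdens ε hε) (by simp)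
  refine tendsto_of_tendsto_of_tendsto_of_le_of_le' hlower tendsto_const_nhds ?_
    (Eventually.of_forall fun ℓ => prob_le_one)
  filter_upwards [h] with ℓ hℓ
  have hcard : (B ℓ).ncard = Fintype.card (B ℓ) := by
    rw [← Nat.card_coe_set_eq, Nat.card_eq_fintype_card]
  have hle := (hperm ℓ).ofReal_mul_measure_ncard_mem_le
    (G := {r | 0 < r ∧ |Real.logb (Fintype.card (B ℓ)) r - d| ≤ ε})
    fun r hr hrB => hℓ r hr.1 hrB hr.2
  simpa only [Set.mem_ofPred_eq, Set.ncard_pos (Set.toFinite _), hcard] using hle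

end RandomSubsets

section ReducedWords

open FreeGroup (IsCyclicallyReduced invRev)

variable {α E : Type*}

theorem isReduced_invRev {w : List (α × Bool)} (h : FreeGroup.IsReduced w) :
    FreeGroup.IsReduced (invRev w) := by
  rw [FreeGroup.IsReduced, invRev, List.isChain_reverse, List.isChain_map]
  exact List.IsChain.imp (fun a b hab hba => by simp [hab hba.symm]) h

theorem isCyclicallyReduced_invRev {w : List (α × Bool)} (h : IsCyclicallyReduced w) :
    IsCyclicallyReduced (invRev w) := by
  refine ⟨isReduced_invRev h.1, ?_⟩
  intro a ha b hb hab
  simp only [invRev, List.getLast?_reverse, List.head?_reverse, List.head?_map,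
    List.getLast?_map, Option.mem_def, Option.map_eq_some_iff] at ha hb
  obtain ⟨a, ha, rfl⟩ := ha
  obtain ⟨b, hb, rfl⟩ := hb
  simpa using (h.2 b hb a ha hab.symm).symm

theorem isReduced_replicate (n : ℕ) (a : α × Bool) : FreeGroup.IsReduced (List.replicate n a) :=
  List.isChain_replicate_of_rel _ fun _ => rfl

theorem isCyclicallyReduced_replicate (n : ℕ) (a : α × Bool) :
    IsCyclicallyReduced (List.replicate n a) := by
  refine ⟨isReduced_replicate n a, fun x hx y hy _ => ?_⟩
  rw [List.eq_of_mem_replicate (List.mem_of_getLast? hx),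
    List.eq_of_mem_replicate (List.mem_of_head? hy)]

theorem isReduced_concat_concat {w : List (α × Bool)} {a b : α × Bool}
    (hw : FreeGroup.IsReduced (w ++ [a])) (hab : a.1 = b.1 → a.2 = b.2) :
    FreeGroup.IsReduced (w ++ [a] ++ [b]) :=
  hw.append_overlap (by simpa [FreeGroup.IsReduced] using hab) (List.cons_ne_nil _ _)

theorem exists_letter_between [Nontrivial α] (a b : α × Bool) :
    ∃ c : α × Bool, (a.1 = c.1 → a.2 = c.2) ∧ (c.1 = b.1 → c.2 = b.2) := by
  obtain ⟨g, hg⟩ := exists_ne a.1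
  rcases eq_or_ne g b.1 with rfl | hgb
  · exact ⟨b, fun h => absurd h.symm hg, fun _ => rfl⟩
  · exact ⟨(g, true), fun h => absurd h.symm hg, fun h => absurd h hgb⟩

theorem invRev_flatMap (w : E → List (α × Bool)) (l : List E) :
    invRev (l.flatMap w) = l.reverse.flatMap fun e => invRev (w e) := by
  simp only [invRev, List.map_flatMap, List.reverse_flatMap]
  rfl

theorem isCyclicallyReduced_flatMap_congr {w w' : E → List (α × Bool)} (hw : ∀ e, w e ≠ [])
    (hred : ∀ e, FreeGroup.IsReduced (w' e)) (hhead : ∀ e, (w' e).head? = (w e).head?)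
    (hlast : ∀ e, (w' e).getLast? = (w e).getLast?) {l : List E}
    (h : IsCyclicallyReduced (l.flatMap w)) : IsCyclicallyReduced (l.flatMap w') := by
  have hw' (e : E) : w' e ≠ [] := by
    simpa only [ne_eq, ← List.head?_eq_none_iff, hhead] using hw e
  obtain ⟨h₁, h₂⟩ := h
  refine ⟨?_, by simpa only [List.head?_flatMap, List.getLast?_flatMap, hhead, hlast] using h₂⟩
  rw [FreeGroup.IsReduced, List.flatMap, List.isChain_flatten (by simpa using fun e _ => hw e),
    List.isChain_map] at h₁
  rw [FreeGroup.IsReduced, List.flatMap, List.isChain_flatten (by simpa using fun e _ => hw' e),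
    List.isChain_map, List.forall_mem_map]
  exact ⟨fun e _ => hred e, by simpa only [hhead, hlast] using h₁.2⟩

theorem flatMap_injective_of_prefix_free {A : Type*} {w : E → List A} (hne : ∀ e, w e ≠ [])
    (hw : ∀ e e', w e <+: w e' → e = e') : Function.Injective (List.flatMap w) := by
  intro l
  induction l with
  | nil => exact fun l' h => (List.eq_nil_iff_forall_not_mem.2 fun e he =>
      hne e (List.flatMap_eq_nil_iff.1 h.symm e he)).symm
  | cons e l ih =>
    rintro (_ | ⟨e', l'⟩) h
    · exact absurd (List.flatMap_eq_nil_iff.1 h e List.mem_cons_self) (hne e)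
    · simp only [List.flatMap_cons] at h
      obtain rfl : e = e' := by
        rcases List.prefix_or_prefix_of_prefix (List.prefix_append (w e) (l.flatMap w))
          (h ▸ List.prefix_append (w e') (l'.flatMap w)) with h' | h'
        exacts [hw _ _ h', (hw _ _ h').symm]
      rw [ih (List.append_cancel_left h)]

theorem eq_of_flatMap_eq_flatMap {A : Type*} {w w' : E → List A}
    (hlen : ∀ e, (w e).length = (w' e).length) {l : List E} (h : l.flatMap w = l.flatMap w') :
    ∀ e ∈ l, w e = w' e := by
  induction l with
  | nil => simp
  | cons e l ih =>
    simp only [List.flatMap_cons] at h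
    obtain ⟨he, hl⟩ := List.append_inj h (hlen e)
    exact List.forall_mem_cons.2 ⟨he, ih hl⟩

theorem eq_of_replicate_concat_prefix {A : Type*} {i j : ℕ} {a a' c c' : A} (hc : c ≠ a)
    (h : List.replicate (i + 1) a ++ [c] <+: List.replicate (j + 1) a' ++ [c']) : i = j := by
  have hle : i ≤ j := by simpa using h.length_le
  by_contra hij
  have hlt : i < j := by omega
  have h₀ : a = a' := by simpa [List.getElem_append] using h.getElem (i := 0) (by simp)
  have h₁ : c = a' := by simpa [List.getElem_append, hlt] using h.getElem (i := i + 1) (by simp)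
  exact hc (h₁.trans h₀.symm)

section Counting

variable [Fintype α]

open Classical in
theorem card_filter_not_inverse (a : α × Bool) :
    (Finset.univ.filter fun c : α × Bool => a.1 = c.1 → a.2 = c.2).card
      = 2 * Fintype.card α - 1 := by
  have : (Finset.univ.filter fun c : α × Bool => a.1 = c.1 → a.2 = c.2)
      = {(a.1, !a.2)}ᶜ := by
    ext ⟨g, ε⟩
    by_cases h : a.1 = g
    · simp [h, eq_comm, Bool.eq_not]
    · simp [h, Ne.symm h]
  simp [this, Finset.card_compl, mul_comm]

/-- The words `x` of length `n` for which the word `a x` is reduced. -/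
noncomputable def reducedExtensions (a : α × Bool) (n : ℕ) : Finset (List (α × Bool)) :=
  ((List.finite_length_eq (α × Bool) n).inter_of_left {x | FreeGroup.IsReduced (a :: x)}).toFinset

theorem mem_reducedExtensions {a : α × Bool} {n : ℕ} {x : List (α × Bool)} :
    x ∈ reducedExtensions a n ↔ x.length = n ∧ FreeGroup.IsReduced (a :: x) := by
  simp [reducedExtensions]

theorem card_reducedExtensions (a : α × Bool) (n : ℕ) :
    (reducedExtensions a n).card = (2 * Fintype.card α - 1) ^ n := by
  classical
  induction n generalizing a with
  | zero =>
    have : reducedExtensions a 0 = {[]} := by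
      ext x
      simp +contextual [mem_reducedExtensions, List.length_eq_zero_iff]
    simp [this]
  | succ n ih =>
    let next := Finset.univ.filter fun c : α × Bool => a.1 = c.1 → a.2 = c.2
    have hsplit : (next.sigma fun c => reducedExtensions c n).card
        = (reducedExtensions a (n + 1)).card := by
      refine Finset.card_nbij (fun p => p.1 :: p.2) ?_ ?_ ?_
      · rintro ⟨c, x⟩ hp
        obtain ⟨hc, hlen, hx⟩ :
            (a.1 = c.1 → a.2 = c.2) ∧ x.length = n ∧ FreeGroup.IsReduced (c :: x) := by
          simpa [next, mem_reducedExtensions] using hp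
        exact mem_reducedExtensions.2 ⟨by simp [hlen], FreeGroup.isReduced_cons_cons.2 ⟨hc, hx⟩⟩
      · rintro ⟨c, x⟩ - ⟨c', x'⟩ - h
        simpa using h
      · intro x hx
        obtain ⟨hlen, hred⟩ := mem_reducedExtensions.1 hx
        obtain ⟨c, y, rfl⟩ := List.exists_cons_of_length_eq_add_one hlen
        obtain ⟨hc, hy⟩ := FreeGroup.isReduced_cons_cons.1 hred
        exact ⟨⟨c, y⟩,
          by simpa [next, mem_reducedExtensions, hy] using ⟨hc, by simpa using hlen⟩, rfl⟩
    rw [← hsplit, Finset.card_sigma, Finset.sum_congr rfl fun c _ => ih c, Finset.sum_const,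
      card_filter_not_inverse, smul_eq_mul, ← pow_succ']

open Classical in
/-- The words `x` of length `n` for which the word `a x b` is reduced. -/
noncomputable def bridges (a b : α × Bool) (n : ℕ) : Finset (List (α × Bool)) :=
  (reducedExtensions a n).filter fun x => FreeGroup.IsReduced (a :: x ++ [b])

theorem mem_bridges {a b : α × Bool} {n : ℕ} {x : List (α × Bool)} :
    x ∈ bridges a b n ↔ x.length = n ∧ FreeGroup.IsReduced (a :: x ++ [b]) := by
  classical
  simp only [bridges, Finset.mem_filter, mem_reducedExtensions]
  exact ⟨fun h => ⟨h.1.1, h.2⟩, fun h => ⟨⟨h.1, h.2.infix (List.prefix_append _ _).isInfix⟩, h.2⟩⟩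

theorem pow_le_card_bridges [Nontrivial α] (a b : α × Bool) (n : ℕ) :
    (2 * Fintype.card α - 1) ^ n ≤ (bridges a b (n + 1)).card := by
  have hext (x : List (α × Bool)) (hx : x ∈ reducedExtensions a n) :
      ∃ c, x ++ [c] ∈ bridges a b (n + 1) := by
    obtain ⟨hlen, hred⟩ := mem_reducedExtensions.1 hx
    obtain ⟨y, z, hyz⟩ := (List.eq_nil_or_concat' (a :: x)).resolve_left (List.cons_ne_nil _ _)
    obtain ⟨c, hac, hcb⟩ := exists_letter_between z b
    refine ⟨c, mem_bridges.2 ⟨by simp [hlen], ?_⟩⟩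
    rw [← List.cons_append, hyz]
    rw [hyz] at hred
    exact isReduced_concat_concat (isReduced_concat_concat hred hac) hcb
  choose! c hc using hext
  rw [← card_reducedExtensions a n]
  exact Finset.card_le_card_of_injOn (fun x => x ++ [c x]) hc
    fun x _ y _ hxy => (List.append_inj' hxy rfl).1

end Counting

end ReducedWords

theorem finite_relatorBall (m ℓ : ℕ) : (relatorBall m ℓ).Finite :=
  (List.finite_length_le _ ℓ).subset fun _ hw => hw.2

theorem ncard_relatorBall_le {m : ℕ} (hm : 2 ≤ m) (ℓ : ℕ) :
    (relatorBall m ℓ).ncard ≤ (2 * m - 1) ^ (ℓ + 2) := by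
  set q := 2 * m - 1 with hq
  let nonemptyWords : Finset (List (Fin m × Bool)) := Finset.univ.biUnion fun a =>
    (Finset.range ℓ).biUnion fun n => (reducedExtensions a n).image (List.cons a)
  have hsub : relatorBall m ℓ ⊆ ↑(insert [] nonemptyWords) := by
    rintro (_ | ⟨a, x⟩) ⟨hred, hlen⟩
    · simp
    · simpa [nonemptyWords, mem_reducedExtensions, hred.1] using hlen
  have hcard : nonemptyWords.card ≤ (q + 1) * ∑ n ∈ Finset.range ℓ, q ^ n := by
    have hletters : q + 1 = (Finset.univ : Finset (Fin m × Bool)).card := by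
      simp [hq]; omega
    rw [hletters]
    refine Finset.card_biUnion_le_card_mul _ _ _ fun a _ => Finset.card_biUnion_le.trans ?_
    refine Finset.sum_le_sum fun n _ => Finset.card_image_le.trans ?_
    rw [card_reducedExtensions, Fintype.card_fin]
  have hgeom : ∑ n ∈ Finset.range ℓ, q ^ n < q ^ ℓ :=
    Nat.geomSum_lt (by omega) fun n hn => Finset.mem_range.1 hn
  calc (relatorBall m ℓ).ncard ≤ (insert [] nonemptyWords).card := by
        rw [← Set.ncard_coe_finset]
        exact Set.ncard_le_ncard hsub (Finset.finite_toSet _)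
    _ ≤ (q + 1) * ∑ n ∈ Finset.range ℓ, q ^ n + 1 :=
        (Finset.card_insert_le _ _).trans (Nat.add_le_add_right hcard 1)
    _ ≤ (q + 1) * q ^ ℓ := by nlinarith
    _ ≤ q ^ 2 * q ^ ℓ := by gcongr; nlinarith [show 3 ≤ q by omega]
    _ = q ^ (ℓ + 2) := by ring

theorem le_ncard_relatorBall {m : ℕ} (hm : 0 < m) (ℓ : ℕ) : ℓ ≤ (relatorBall m ℓ).ncard := by
  let power (n : ℕ) : List (Fin m × Bool) := List.replicate n (⟨0, hm⟩, true)
  have hinj : Function.Injective power := fun i j h => by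
    simpa [power] using congrArg List.length h
  have hsub : power '' Finset.range ℓ ⊆ relatorBall m ℓ := by
    rintro _ ⟨n, hn, rfl⟩
    exact ⟨isCyclicallyReduced_replicate n _, by simpa [power] using (Finset.mem_range.1 hn).le⟩
  have hcard := Set.ncard_le_ncard hsub (finite_relatorBall m ℓ)
  rwa [Set.ncard_image_of_injective _ hinj, Set.ncard_coe_finset, Finset.card_range] at hcard

section Codebooks

open FreeGroup (invRev)

variable {α E : Type*}

/-- A finite set of words to choose from on every edge `e`, compatible with the inversion `i` of the
edges: reduced words of length `n e` starting with the letter `a e`. The last letter is prescribed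
as well, through the first letter on `i e`. Prefix-freeness allows the edges to be read off from a
concatenation of such words. -/
structure IsCodebook (i : E → E) (n : E → ℕ) (a : E → α × Bool)
    (U : E → Finset (List (α × Bool))) : Prop where
  invRev_mem : ∀ e, ∀ u ∈ U e, invRev u ∈ U (i e)
  length_eq : ∀ e, ∀ u ∈ U e, u.length = n e
  isReduced : ∀ e, ∀ u ∈ U e, FreeGroup.IsReduced u
  head?_eq : ∀ e, ∀ u ∈ U e, u.head? = some (a e)
  eq_of_prefix : ∀ e e', ∀ u ∈ U e, ∀ u' ∈ U e', u <+: u' → e = e'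

theorem isReduced_replicate_concat {a c : α × Bool} (h : c.1 ≠ a.1) (k : ℕ) :
    FreeGroup.IsReduced (List.replicate (k + 1) a ++ [c]) := by
  rw [List.replicate_succ']
  exact isReduced_concat_concat (List.replicate_succ' ▸ isReduced_replicate (k + 1) a)
    fun hac => absurd hac.symm h

theorem isReduced_append_append_invRev {u v x : List (α × Bool)} {c d : α × Bool}
    (hu : FreeGroup.IsReduced (u ++ [c])) (hv : FreeGroup.IsReduced (v ++ [d]))
    (hx : FreeGroup.IsReduced (c :: x ++ [(d.1, !d.2)])) :
    FreeGroup.IsReduced (u ++ [c] ++ x ++ invRev (v ++ [d])) := by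
  have hv' : invRev (v ++ [d]) = [(d.1, !d.2)] ++ invRev v := by simp [invRev]
  have hux : FreeGroup.IsReduced (u ++ [c] ++ (x ++ [(d.1, !d.2)])) :=
    hu.append_overlap hx (List.cons_ne_nil _ _)
  have := isReduced_invRev hv
  rw [hv'] at this ⊢
  rw [← List.append_assoc] at hux ⊢
  exact hux.append_overlap this (List.cons_ne_nil _ _)

/-- The words `u c x d⁻¹ v⁻¹` of length `n` for which `c x d⁻¹` is reduced. -/
noncomputable def framedWords [Fintype α] (u v : List (α × Bool)) (c d : α × Bool) (n : ℕ) :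
    Finset (List (α × Bool)) :=
  open Classical in (bridges c (d.1, !d.2) (n - (u.length + v.length + 2))).image
    fun x => u ++ [c] ++ x ++ invRev (v ++ [d])

section FramedWords

variable [Fintype α] {u v w : List (α × Bool)} {c d : α × Bool} {n : ℕ}

theorem mem_framedWords : w ∈ framedWords u v c d n ↔
    ∃ x, (x.length = n - (u.length + v.length + 2) ∧
      FreeGroup.IsReduced (c :: x ++ [(d.1, !d.2)])) ∧
      u ++ [c] ++ x ++ invRev (v ++ [d]) = w := by
  simp only [framedWords, Finset.mem_image, mem_bridges]

theorem invRev_mem_framedWords (hw : w ∈ framedWords u v c d n) :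
    invRev w ∈ framedWords v u d c n := by
  obtain ⟨x, ⟨hlen, hx⟩, rfl⟩ := mem_framedWords.1 hw
  refine mem_framedWords.2 ⟨invRev x, ⟨?_, ?_⟩, ?_⟩
  · rw [FreeGroup.invRev_length, hlen, add_comm u.length]
  · simpa [invRev] using isReduced_invRev hx
  · simp only [FreeGroup.invRev_append, FreeGroup.invRev_invRev, List.append_assoc]

theorem length_of_mem_framedWords (hn : u.length + v.length + 2 ≤ n)
    (hw : w ∈ framedWords u v c d n) : w.length = n := by
  obtain ⟨x, ⟨hlen, -⟩, rfl⟩ := mem_framedWords.1 hw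
  simp only [List.length_append, FreeGroup.invRev_length, List.length_singleton]
  omega

theorem isReduced_of_mem_framedWords (hu : FreeGroup.IsReduced (u ++ [c]))
    (hv : FreeGroup.IsReduced (v ++ [d])) (hw : w ∈ framedWords u v c d n) :
    FreeGroup.IsReduced w := by
  obtain ⟨x, ⟨-, hx⟩, rfl⟩ := mem_framedWords.1 hw
  exact isReduced_append_append_invRev hu hv hx

theorem concat_prefix_of_mem_framedWords (hw : w ∈ framedWords u v c d n) : u ++ [c] <+: w := by
  obtain ⟨x, -, rfl⟩ := mem_framedWords.1 hw
  exact ⟨x ++ invRev (v ++ [d]), (List.append_assoc _ _ _).symm⟩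

theorem pow_le_mul_card_framedWords [Nontrivial α] {j : ℕ} (hj : u.length + v.length + 3 ≤ j)
    (hn : j ≤ n) : (2 * Fintype.card α - 1) ^ n ≤
      (2 * Fintype.card α - 1) ^ j * (framedWords u v c d n).card := by
  classical
  have hinj : Function.Injective fun x => u ++ [c] ++ x ++ invRev (v ++ [d]) := fun x y hxy =>
    List.append_cancel_left (List.append_cancel_right hxy)
  have hbridges := pow_le_card_bridges c (d.1, !d.2) (n - (u.length + v.length + 3))
  rw [show n - (u.length + v.length + 3) + 1 = n - (u.length + v.length + 2) by omega,
    ← Finset.card_image_of_injective _ hinj] at hbridges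
  refine le_trans ?_ (Nat.mul_le_mul_left _ hbridges)
  rw [← pow_add]
  exact Nat.pow_le_pow_right (by have := Fintype.card_pos (α := α); omega) (by omega)

end FramedWords

theorem exists_isCodebook [Fintype α] [Nontrivial α] [Fintype E] {i : E → E}
    (hi : Function.Involutive i) {n : E → ℕ} (hn : ∀ e, 2 * Fintype.card E + 3 ≤ n e)
    (hni : ∀ e, n (i e) = n e) (a : E → α × Bool) :
    ∃ U : E → Finset (List (α × Bool)), IsCodebook i n a U ∧ ∀ e,
      (2 * Fintype.card α - 1) ^ n e ≤
        (2 * Fintype.card α - 1) ^ (2 * Fintype.card E + 3) * (U e).card := by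
  -- The prefixes `(a e)^k c` are told apart by the exponent `k`, which is specific to `e`.
  choose g hg using fun e => exists_ne (a e).1
  let c (e : E) : α × Bool := (g e, true)
  let k (e : E) : ℕ := Fintype.equivFin E e
  let pre (e : E) : List (α × Bool) := List.replicate (k e + 1) (a e)
  have hk (e : E) : k e < Fintype.card E := (Fintype.equivFin E e).2
  have hlen (e : E) : (pre e).length + (pre (i e)).length + 3 ≤ 2 * Fintype.card E + 3 := by
    have := hk e
    have := hk (i e)
    simp only [pre, List.length_replicate]
    omega
  have hpre (e : E) : FreeGroup.IsReduced (pre e ++ [c e]) :=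
    isReduced_replicate_concat (hg e) (k e)
  refine ⟨fun e => framedWords (pre e) (pre (i e)) (c e) (c (i e)) (n e), ⟨fun e u hu => ?_,
    fun e u hu => length_of_mem_framedWords ((Nat.le_succ _).trans ((hlen e).trans (hn e))) hu,
    fun e u hu => isReduced_of_mem_framedWords (hpre e) (hpre (i e)) hu,
    fun e u hu => ?_, fun e e' u hu u' hu' h => ?_⟩,
    fun e => pow_le_mul_card_framedWords (hlen e) (hn e)⟩
  · simpa only [hi e, hni] using invRev_mem_framedWords hu
  · obtain ⟨x, rfl⟩ := concat_prefix_of_mem_framedWords hu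
    simp [pre, List.replicate_succ]
  · have hne (e : E) : c e ≠ a e := fun h => hg e (congrArg Prod.fst h)
    have hkk : k e = k e' := by
      rcases List.prefix_or_prefix_of_prefix ((concat_prefix_of_mem_framedWords hu).trans h)
        (concat_prefix_of_mem_framedWords hu') with h | h
      exacts [eq_of_replicate_concat_prefix (hne e) h,
        (eq_of_replicate_concat_prefix (hne e') h).symm]
    exact (Fintype.equivFin E).injective (Fin.ext hkk)

end Codebooks

/-- `s` contains exactly one of `a` and `i a`, for every `a`. -/
def IsOrientation {A : Type*} (i : A → A) (s : Finset A) : Prop :=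
  ∀ a, i a ∈ s ↔ a ∉ s

theorem exists_isOrientation {A : Type*} [Finite A] {i : A → A} (hi : Function.Involutive i)
    (hne : ∀ a, i a ≠ a) : ∃ s, IsOrientation i s := by
  classical
  have := Fintype.ofFinite A
  let k := Fintype.equivFin A
  refine ⟨Finset.univ.filter fun a => k a < k (i a), fun a => ?_⟩
  have hk : k (i a) ≠ k a := fun h => hne a (k.injective h)
  simp only [Finset.mem_filter, Finset.mem_univ, true_and, hi a, not_lt]
  exact ⟨le_of_lt, fun h => lt_of_le_of_ne h hk⟩

namespace TwoComplex

variable {V E F : Type*} (Y : TwoComplex V E F)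

section FaceSpan

theorem inv_mem_bdry_finv {f : F} {e : E} (he : e ∈ Y.bdry f) : Y.inv e ∈ Y.bdry (Y.finv f) := by
  rw [Y.bdry_finv, List.mem_reverse]
  exact List.mem_map_of_mem he

/-- The sub-2-complex spanned by a set of faces, with all vertices of `Y`: only edges and faces are
counted. -/
def faceSpan (T : Set F) : Y.Sub where
  verts := Set.univ
  edges := {e | ∃ f ∈ T, e ∈ Y.bdry f ∨ e ∈ Y.bdry (Y.finv f)}
  faces := {f | f ∈ T ∨ Y.finv f ∈ T}
  src_mem _ _ := trivial
  inv_mem := by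
    rintro e ⟨f, hf, he⟩
    exact ⟨f, hf, he.symm.imp (fun h => Y.finv_finv f ▸ Y.inv_mem_bdry_finv h)
      Y.inv_mem_bdry_finv⟩
  finv_mem f hf := hf.symm.imp_right fun h => (Y.finv_finv f).symm ▸ h
  bdry_mem f hf e he := hf.elim (fun h => ⟨f, h, Or.inl he⟩)
    fun h => ⟨_, h, Or.inr (by rwa [Y.finv_finv])⟩

theorem numFaces_faceSpan {F₀ T : Finset F} (hF : IsOrientation Y.finv F₀) (hT : T ⊆ F₀) :
    (Y.faceSpan T).numFaces = T.card := by
  have h : (fun f => s(f, Y.finv f)) '' (Y.faceSpan T).faces = (fun f => s(f, Y.finv f)) '' T := by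
    refine Set.Subset.antisymm ?_ (Set.image_mono fun f hf => Or.inl hf)
    rintro _ ⟨f, hf | hf, rfl⟩
    · exact ⟨f, hf, rfl⟩
    · exact ⟨_, hf, by simp only [Y.finv_finv]; exact Sym2.eq_swap⟩
  rw [Sub.numFaces, h, Set.InjOn.ncard_image, Set.ncard_coe_finset]
  intro f hf g hg hfg
  rcases Sym2.eq_iff.1 hfg with h | h
  · exact h.1
  · exact absurd (hT hf) ((hF f).1 (h.2 ▸ hT hg))

theorem numEdges_le_card {Z : Y.Sub} {s : Finset E}
    (hs : ∀ e ∈ Z.edges, e ∈ s ∨ Y.inv e ∈ s) : Z.numEdges ≤ s.card := by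
  have hsub : (fun e => s(e, Y.inv e)) '' Z.edges ⊆ (fun e => s(e, Y.inv e)) '' (s : Set E) := by
    rintro _ ⟨e, he, rfl⟩
    rcases hs e he with h | h
    · exact ⟨e, h, rfl⟩
    · exact ⟨Y.inv e, h, by simp only [Y.inv_inv]; exact Sym2.eq_swap⟩
  calc Z.numEdges ≤ ((fun e => s(e, Y.inv e)) '' (s : Set E)).ncard :=
        Set.ncard_le_ncard hsub (s.finite_toSet.image _)
    _ ≤ s.card := (Set.ncard_image_le s.finite_toSet).trans_eq (Set.ncard_coe_finset s)

theorem numEdges_faceSpan_singleton_le (f : F) :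
    (Y.faceSpan {f}).numEdges ≤ (Y.bdry f).length := by
  classical
  refine (Y.numEdges_le_card (s := (Y.bdry f).toFinset) ?_).trans (List.toFinset_card_le _)
  rintro e ⟨f, rfl, he | he⟩
  · exact Or.inl (List.mem_toFinset.2 he)
  · exact Or.inr (List.mem_toFinset.2 (Y.finv_finv f ▸ Y.inv_mem_bdry_finv he))

variable {n : E → ℕ} (hpos : ∀ e, 0 < n e) (hinv : ∀ e, n (Y.inv e) = n e)

theorem mem_edges_faceSpan_of_subdivide {T : Set F} {p : SubdivEdge n}
    (hp : p ∈ ((Y.subdivide n hpos hinv).faceSpan T).edges) : p.1.1 ∈ (Y.faceSpan T).edges := by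
  have hbdry {f : F} (hp : p ∈ (Y.subdivide n hpos hinv).bdry f) : p.1.1 ∈ Y.bdry f := by
    obtain ⟨e, he, hp⟩ := List.mem_flatMap.1 hp
    obtain ⟨i, -, rfl⟩ := List.mem_map.1 hp
    exact he
  obtain ⟨f, hf, h⟩ := hp
  exact ⟨f, hf, h.imp hbdry hbdry⟩

open Classical in
theorem numEdges_faceSpan_subdivide_le {E₀ : Finset E} (hE : IsOrientation Y.inv E₀) (T : Set F) :
    ((Y.subdivide n hpos hinv).faceSpan T).numEdges ≤
      ∑ e ∈ E₀ with e ∈ (Y.faceSpan T).edges, n e := by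
  let segments : Finset (SubdivEdge n) := (E₀.filter (· ∈ (Y.faceSpan T).edges)).biUnion
    fun e => (subdivArc n e).toFinset
  have hcard (e : E) : (subdivArc n e).toFinset.card ≤ n e :=
    (List.toFinset_card_le _).trans_eq (by simp [subdivArc])
  have hmem {p : SubdivEdge n} (h : p.1.1 ∈ E₀)
      (hp : p ∈ ((Y.subdivide n hpos hinv).faceSpan T).edges) : p ∈ segments := by
    refine Finset.mem_biUnion.2 ⟨p.1.1, Finset.mem_filter.2
      ⟨h, Y.mem_edges_faceSpan_of_subdivide hpos hinv hp⟩, List.mem_toFinset.2 ?_⟩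
    exact List.mem_map.2 ⟨⟨p.1.2, p.2⟩, List.mem_finRange _, rfl⟩
  refine ((Y.subdivide n hpos hinv).numEdges_le_card (s := segments) fun p hp => ?_).trans
    (Finset.card_biUnion_le.trans (Finset.sum_le_sum fun e _ => hcard e))
  by_cases h : p.1.1 ∈ E₀
  · exact Or.inl (hmem h hp)
  · exact Or.inr (hmem ((hE p.1.1).2 h) (Sub.inv_mem _ p hp))

end FaceSpan

section WordLabelings

variable {X : Type*}

/-- The word read along the boundary of a face when the edges are labeled by words. -/
def faceWord (w : E → List (X × Bool)) (f : F) : List (X × Bool) :=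
  (Y.bdry f).flatMap w

/-- A labeling of the edges of `Y` by words, with lengths `n`: this is the same thing as a labeling
by letters of the edges of the subdivision of `Y` into `n` parts. -/
structure IsWordLabeling (n : E → ℕ) (w : E → List (X × Bool)) : Prop where
  length_eq : ∀ e, (w e).length = n e
  inv_eq : ∀ e, w (Y.inv e) = FreeGroup.invRev (w e)

variable {Y} {n : E → ℕ} {hpos : ∀ e, 0 < n e} {hinv : ∀ e, n (Y.inv e) = n e}
  {R : Set (List (X × Bool))}

theorem IsWordLabeling.faceWord_finv {w : E → List (X × Bool)} (hw : Y.IsWordLabeling n w) (f : F) :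
    Y.faceWord w (Y.finv f) = FreeGroup.invRev (Y.faceWord w f) := by
  simp only [faceWord, Y.bdry_finv, invRev_flatMap, ← List.map_reverse, List.flatMap_map, hw.inv_eq]

theorem IsWordLabeling.eq_of_faceWord_eq {w w' : E → List (X × Bool)} (hw : Y.IsWordLabeling n w)
    (hw' : Y.IsWordLabeling n w') {T : Set F} (h : ∀ f ∈ T, Y.faceWord w f = Y.faceWord w' f)
    {e : E} (he : e ∈ (Y.faceSpan T).edges) : w e = w' e := by
  have hlen (e : E) : (w e).length = (w' e).length := (hw.length_eq e).trans (hw'.length_eq e).symm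
  obtain ⟨f, hf, he | he⟩ := he
  · exact eq_of_flatMap_eq_flatMap hlen (h f hf) e he
  · refine eq_of_flatMap_eq_flatMap hlen (l := Y.bdry (Y.finv f)) ?_ e he
    change Y.faceWord w _ = Y.faceWord w' _
    rw [hw.faceWord_finv, hw'.faceWord_finv, h f hf]

theorem IsWordLabeling.fillable_subdivide {w : E → List (X × Bool)} (hw : Y.IsWordLabeling n w)
    (hinj : Function.Injective (Y.faceWord w))
    (hR : ∀ f, Y.faceWord w f ∈ R ∨ FreeGroup.invRev (Y.faceWord w f) ∈ R) :
    (Y.subdivide n hpos hinv).Fillable R := by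
  let letter (p : SubdivEdge n) : X × Bool := (w p.1.1)[p.1.2]'(hw.length_eq p.1.1 ▸ p.2)
  have harc (e : E) : (subdivArc n e).map letter = w e :=
    List.ext_getElem (by simp [subdivArc, hw.length_eq]) fun i h₁ h₂ => by simp [subdivArc, letter]
  refine ⟨⟨letter, Y.faceWord w, fun p => ?_, hR, hw.faceWord_finv, fun f => ?_⟩, ?_⟩
  · have := p.2
    have hlen := hw.length_eq p.1.1
    have hidx : (w p.1.1).length - 1 - (n p.1.1 - 1 - p.1.2) = p.1.2 := by omega
    simp only [letter, subdivide, hw.inv_eq, FreeGroup.invRev, List.getElem_reverse,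
      List.getElem_map, List.length_map, hidx]
  · simp only [subdivide, List.map_flatMap, harc, faceWord]
  · rintro ⟨f, f', hne, h, -⟩
    exact hne (hinj h)

namespace VanKampen

/-- The word read along an edge of `Y` in a van Kampen complex on a subdivision of `Y`. -/
def edgeWord (D : (Y.subdivide n hpos hinv).VanKampen R) (e : E) : List (X × Bool) :=
  (subdivArc n e).map D.edgeLabel

variable (D : (Y.subdivide n hpos hinv).VanKampen R)

theorem isWordLabeling_edgeWord : Y.IsWordLabeling n D.edgeWord where
  length_eq e := by simp [edgeWord, subdivArc]
  inv_eq e := by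
    rw [edgeWord, Y.subdivArc_inv n hinv (Y.subdivide n hpos hinv).inv (fun _ => rfl),
      FreeGroup.invRev, edgeWord, List.map_reverse, List.map_map, List.map_map]
    congr 2
    funext p
    exact D.edgeLabel_inv p

theorem faceLabel_eq_faceWord (f : F) : D.faceLabel f = Y.faceWord D.edgeWord f :=
  (D.compatible f).symm.trans List.map_flatMap

theorem IsReduced.bdry_injective {D : (Y.subdivide n hpos hinv).VanKampen R} (hD : D.IsReduced) :
    Function.Injective Y.bdry := by
  intro f f' h
  by_contra hne
  have hb : (Y.subdivide n hpos hinv).bdry f = (Y.subdivide n hpos hinv).bdry f' := by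
    simp only [subdivide, h]
  have hlen := List.length_pos_of_ne_nil ((Y.subdivide n hpos hinv).bdry_ne_nil f)
  refine hD ⟨f, f', hne, ?_, 0, ((Y.subdivide n hpos hinv).bdry f)[0], by simp, by simp [← hb]⟩
  rw [← D.compatible, ← D.compatible, hb]

end VanKampen

end WordLabelings

section RelatorBall

variable {Y} {m ℓ : ℕ}

theorem VanKampen.faceLabel_mem_relatorBall (D : Y.VanKampen (relatorBall m ℓ)) (f : F) :
    D.faceLabel f ∈ relatorBall m ℓ := by
  rcases D.faceLabel_mem f with h | ⟨hred, hlen⟩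
  · exact h
  · exact ⟨FreeGroup.invRev_invRev (L₁ := D.faceLabel f) ▸ isCyclicallyReduced_invRev hred,
      by rwa [FreeGroup.invRev_length] at hlen⟩

theorem numEdges_faceSpan_singleton_le_of_fillable (hfill : Y.Fillable (relatorBall m ℓ)) (f : F) :
    (Y.faceSpan {f}).numEdges ≤ ℓ := by
  obtain ⟨D, -⟩ := hfill
  have hlen := (D.faceLabel_mem_relatorBall f).2
  rw [← D.compatible f, List.length_map] at hlen
  exact (Y.numEdges_faceSpan_singleton_le f).trans hlen

variable {n : E → ℕ} {hpos : ∀ e, 0 < n e} {hinv : ∀ e, n (Y.inv e) = n e}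
  {U : E → Finset (List (Fin m × Bool))} {w : E → List (Fin m × Bool)}

theorem faceWord_mem_relatorBall_of_isCodebook
    (D : (Y.subdivide n hpos hinv).VanKampen (relatorBall m ℓ))
    (hU : IsCodebook Y.inv n (fun e => D.edgeLabel ⟨(e, 0), hpos e⟩) U) (hw : ∀ e, w e ∈ U e)
    (f : F) : Y.faceWord w f ∈ relatorBall m ℓ := by
  have hD := D.isWordLabeling_edgeWord
  have hlen (e : E) : (w e).length = (D.edgeWord e).length :=
    (hU.length_eq e _ (hw e)).trans (hD.length_eq e).symm
  have hDhead (e : E) : (D.edgeWord e).head? = some (D.edgeLabel ⟨(e, 0), hpos e⟩) := by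
    simp [VanKampen.edgeWord, subdivArc, List.head?_eq_getElem?, hpos e]
  have hlast_eq (u : List (Fin m × Bool)) :
      u.getLast? = (FreeGroup.invRev u).head?.map fun b => (b.1, !b.2) := by
    simp [FreeGroup.invRev, Function.comp_def]
  obtain ⟨hred, hball⟩ := D.faceLabel_mem_relatorBall f
  rw [D.faceLabel_eq_faceWord] at hred hball
  refine ⟨isCyclicallyReduced_flatMap_congr (w := D.edgeWord) (fun e => ?_)
    (fun e => hU.isReduced e _ (hw e)) (fun e => ?_) (fun e => ?_) hred, ?_⟩
  · exact List.ne_nil_of_length_pos ((hD.length_eq e).symm ▸ hpos e)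
  · rw [hU.head?_eq e _ (hw e), hDhead]
  · rw [hlast_eq, hlast_eq, ← hD.inv_eq, hDhead, hU.head?_eq _ _ (hU.invRev_mem e _ (hw e))]
  · simpa only [faceWord, List.length_flatMap, hlen] using hball

theorem faceWord_injective_of_isCodebook {a : E → Fin m × Bool} (hU : IsCodebook Y.inv n a U)
    (hpos : ∀ e, 0 < n e) (hw : ∀ e, w e ∈ U e) (hY : Function.Injective Y.bdry) :
    Function.Injective (Y.faceWord w) := by
  have hne (e : E) : w e ≠ [] :=
    List.ne_nil_of_length_pos ((hU.length_eq e _ (hw e)).symm ▸ hpos e)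
  exact (flatMap_injective_of_prefix_free hne fun e e' =>
    hU.eq_of_prefix e e' _ (hw e) _ (hw e')).comp hY

end RelatorBall

end TwoComplex

section Counting

open Classical in
theorem card_mul_prod_le_of_determined {ι β : Type*} [Fintype ι] {U : ι → Finset β}
    (s : Finset ι) {A : Finset (ι → β)} (hA : A ⊆ Fintype.piFinset U)
    (hdet : ∀ x ∈ A, ∀ y ∈ A, ∀ i ∈ s, x i = y i) :
    A.card * ∏ i ∈ s, (U i).card ≤ (Fintype.piFinset U).card := by
  have hrestrict : A.card ≤ (Fintype.piFinset fun i : {i // i ∉ s} => U i).card := by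
    refine Finset.card_le_card_of_injOn (fun x i => x i) (fun x hx => ?_) fun x hx y hy hxy => ?_
    · exact Fintype.mem_piFinset.2 fun i => Fintype.mem_piFinset.1 (hA hx) i
    · funext i
      by_cases hi : i ∈ s
      exacts [hdet x hx y hy i hi, congrFun hxy ⟨i, hi⟩]
  rw [Fintype.card_piFinset, ← Finset.prod_subtype sᶜ (by simp) fun i => (U i).card] at hrestrict
  rw [Fintype.card_piFinset, ← Finset.prod_compl_mul_prod s]
  exact Nat.mul_le_mul_right _ hrestrict

theorem mul_pow_le_rpow_mul {q A N ρ t δ : ℝ} {C i j : ℕ} (hq : 1 ≤ q) (hA : 0 ≤ A) (hN : 0 ≤ N)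
    (hcount : A * q ^ j ≤ q ^ C * N) (hρ₀ : 0 ≤ ρ) (hρ : ρ ≤ q ^ t) (hδ : 0 ≤ δ) (hi : 1 ≤ i)
    (hj : (t + δ) * i ≤ j) : A * ρ ^ i ≤ q ^ (C - δ) * N := by
  have hq₀ : 0 < q := by linarith
  have hexp : t * i + C ≤ C - δ + j := by nlinarith [(Nat.one_le_cast (α := ℝ)).2 hi]
  refine le_of_mul_le_mul_right ?_ (pow_pos hq₀ j)
  calc A * ρ ^ i * q ^ j = ρ ^ i * (A * q ^ j) := by ring
    _ ≤ (q ^ t) ^ i * (q ^ C * N) := by gcongr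
    _ = q ^ (t * i + C) * N := by
        rw [Real.rpow_add hq₀, Real.rpow_mul hq₀.le, Real.rpow_natCast, Real.rpow_natCast]
        ring
    _ ≤ q ^ (C - δ + j) * N := by gcongr
    _ = q ^ (C - δ) * N * q ^ j := by rw [Real.rpow_add hq₀, Real.rpow_natCast]; ring

end Counting

noncomputable instance (m ℓ : ℕ) : Fintype (relatorBall m ℓ) :=
  (finite_relatorBall m ℓ).fintype

open Classical in
/-- The labeling of the edges which agrees with `x` on the orientation `E₀` and turns the inversion
`i` of the edges into the inversion of words. -/
noncomputable def symmetrize {α E : Type*} (i : E → E) (E₀ : Finset E)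
    (x : E → List (α × Bool)) (e : E) : List (α × Bool) :=
  if e ∈ E₀ then x e else FreeGroup.invRev (x (i e))

theorem symmetrize_inv {α E : Type*} {i : E → E} {E₀ : Finset E} (hE : IsOrientation i E₀)
    (hi : Function.Involutive i) (x : E → List (α × Bool)) (e : E) :
    symmetrize i E₀ x (i e) = FreeGroup.invRev (symmetrize i E₀ x e) := by
  by_cases h : e ∈ E₀
  · simp [symmetrize, hE e, h, hi e]
  · simp [symmetrize, hE e, h]

theorem IsCodebook.symmetrize_mem {α E : Type*} {i : E → E} {n : E → ℕ} {a : E → α × Bool}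
    {U : E → Finset (List (α × Bool))} (hU : IsCodebook i n a U) (hi : Function.Involutive i)
    (E₀ : Finset E) {x : E → List (α × Bool)} (hx : ∀ e, x e ∈ U e) (e : E) :
    symmetrize i E₀ x e ∈ U e := by
  by_cases h : e ∈ E₀
  · simpa only [symmetrize, h, if_true] using hx e
  · simpa only [symmetrize, h, if_false, hi e] using hU.invRev_mem (i e) _ (hx (i e))

namespace TwoComplex

variable {V E F : Type*} {Y : TwoComplex V E F} {n : E → ℕ} {hpos : ∀ e, 0 < n e}
  {hinv : ∀ e, n (Y.inv e) = n e} {m ℓ : ℕ}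

theorem isWordLabeling_symmetrize {α : Type*} {a : E → α × Bool} {U : E → Finset (List (α × Bool))}
    (hU : IsCodebook Y.inv n a U) {E₀ : Finset E} (hE : IsOrientation Y.inv E₀)
    {x : E → List (α × Bool)} (hx : ∀ e, x e ∈ U e) :
    Y.IsWordLabeling n (symmetrize Y.inv E₀ x) where
  length_eq e := hU.length_eq e _ (hU.symmetrize_mem Y.inv_inv E₀ hx e)
  inv_eq := symmetrize_inv hE Y.inv_inv x

open Classical in
theorem card_mul_pow_numEdges_le_of_faceWord_eq [Fintype E] {α : Type*} {a : E → α × Bool}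
    {U : E → Finset (List (α × Bool))} (hU : IsCodebook Y.inv n a U) {E₀ : Finset E}
    (hE : IsOrientation Y.inv E₀) {q C : ℕ} (hq : 0 < q) (hcard : ∀ e, q ^ n e ≤ q ^ C * (U e).card)
    {T : Finset F} {g : F → List (α × Bool)} {A : Finset (E → List (α × Bool))}
    (hA : A ⊆ Fintype.piFinset U)
    (hAg : ∀ x ∈ A, ∀ f ∈ T, Y.faceWord (symmetrize Y.inv E₀ x) f = g f) :
    A.card * q ^ ((Y.subdivide n hpos hinv).faceSpan T).numEdges ≤
      q ^ (Fintype.card E * C) * (Fintype.piFinset U).card := by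
  let s := E₀.filter fun e => e ∈ (Y.faceSpan T).edges
  have hdet : ∀ x ∈ A, ∀ y ∈ A, ∀ e ∈ s, x e = y e := fun x hx y hy e he => by
    obtain ⟨he₀, he⟩ := Finset.mem_filter.1 he
    have := (isWordLabeling_symmetrize hU hE (Fintype.mem_piFinset.1 (hA hx))).eq_of_faceWord_eq
      (isWordLabeling_symmetrize hU hE (Fintype.mem_piFinset.1 (hA hy)))
      (fun f hf => (hAg x hx f hf).trans (hAg y hy f hf).symm) he
    simpa only [symmetrize, he₀, if_true] using this
  have hprod : q ^ ∑ e ∈ s, n e ≤ q ^ (Fintype.card E * C) * ∏ e ∈ s, (U e).card := by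
    calc q ^ ∑ e ∈ s, n e ≤ ∏ e ∈ s, q ^ C * (U e).card := by
          rw [← Finset.prod_pow_eq_pow_sum]
          exact Finset.prod_le_prod' fun e _ => hcard e
      _ = q ^ (s.card * C) * ∏ e ∈ s, (U e).card := by
          rw [Finset.prod_mul_distrib, Finset.prod_const, ← pow_mul, mul_comm C]
      _ ≤ q ^ (Fintype.card E * C) * ∏ e ∈ s, (U e).card := by
          gcongr
          exact s.card_le_univ
  calc A.card * q ^ ((Y.subdivide n hpos hinv).faceSpan T).numEdges
      ≤ A.card * (q ^ (Fintype.card E * C) * ∏ e ∈ s, (U e).card) := by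
        refine Nat.mul_le_mul_left _ (le_trans ?_ hprod)
        exact Nat.pow_le_pow_right hq (Y.numEdges_faceSpan_subdivide_le hpos hinv hE T)
    _ = q ^ (Fintype.card E * C) * (A.card * ∏ e ∈ s, (U e).card) := by ring
    _ ≤ q ^ (Fintype.card E * C) * (Fintype.piFinset U).card := by
        gcongr
        exact card_mul_prod_le_of_determined s hA hdet

section Relators

open Classical in
/-- The relators read along the faces in `F₀` when the edges are labeled by the words `w`. -/
noncomputable def relators (Y : TwoComplex V E F) (ℓ : ℕ) (F₀ : Finset F)
    (w : E → List (Fin m × Bool)) : Finset (relatorBall m ℓ) :=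
  (F₀.image (Y.faceWord w)).subtype (· ∈ relatorBall m ℓ)

variable {F₀ : Finset F} {w w' : E → List (Fin m × Bool)}

theorem mem_relators {u : relatorBall m ℓ} :
    u ∈ Y.relators ℓ F₀ w ↔ ∃ f ∈ F₀, Y.faceWord w f = u := by
  simp [relators]

theorem card_relators (hball : ∀ f, Y.faceWord w f ∈ relatorBall m ℓ)
    (hinj : Function.Injective (Y.faceWord w)) : (Y.relators ℓ F₀ w).card = F₀.card := by
  classical
  rw [relators, Finset.card_subtype, Finset.filter_true_of_mem (by simpa using fun f _ => hball f),
    Finset.card_image_of_injective _ hinj]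

theorem IsWordLabeling.fillable_of_relators_subset (hw : Y.IsWordLabeling n w)
    (hball : ∀ f, Y.faceWord w f ∈ relatorBall m ℓ) (hinj : Function.Injective (Y.faceWord w))
    (hF : IsOrientation Y.finv F₀) {S : Set (relatorBall m ℓ)} (hS : ↑(Y.relators ℓ F₀ w) ⊆ S) :
    (Y.subdivide n hpos hinv).Fillable (Subtype.val '' S) := by
  have hmem {f : F} (hf : f ∈ F₀) : Y.faceWord w f ∈ Subtype.val '' S :=
    ⟨⟨_, hball f⟩, hS (mem_relators.2 ⟨f, hf, rfl⟩), rfl⟩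
  refine hw.fillable_subdivide hinj fun f => ?_
  by_cases hf : f ∈ F₀
  · exact Or.inl (hmem hf)
  · exact Or.inr (hw.faceWord_finv f ▸ hmem ((hF f).2 hf))

open Classical in
theorem exists_faceWord_eq_of_relators_inter (hball : ∀ f, Y.faceWord w f ∈ relatorBall m ℓ)
    (hinj : Function.Injective (Y.faceWord w)) :
    ∃ T ⊆ F₀, ∃ τ : F → F, T.card = (Y.relators ℓ F₀ w ∩ Y.relators ℓ F₀ w').card ∧
      ∀ f ∈ T, Y.faceWord w f = Y.faceWord w' (τ f) := by
  let T := F₀.filter fun f => ∃ g ∈ F₀, Y.faceWord w' g = Y.faceWord w f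
  have hT : ∀ f ∈ T, ∃ g, Y.faceWord w f = Y.faceWord w' g := fun f hf =>
    let ⟨g, _, hg⟩ := (Finset.mem_filter.1 hf).2
    ⟨g, hg.symm⟩
  have := fun f : F => Nonempty.intro f
  choose! τ hτ using hT
  refine ⟨T, Finset.filter_subset _ _, τ, ?_, hτ⟩
  rw [← card_relators hball hinj]
  congr 1
  ext u
  simp only [T, mem_relators, Finset.mem_inter, Finset.mem_filter]
  constructor
  · rintro ⟨f, ⟨hf, g, hg, hgf⟩, hu⟩
    exact ⟨⟨f, hf, hu⟩, g, hg, hgf.trans hu⟩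
  · rintro ⟨⟨f, hf, hu⟩, g, hg, hgu⟩
    exact ⟨f, ⟨hf, g, hg, hgu.trans hu.symm⟩, hu⟩

end Relators

section FixedScale

variable [Fintype E] {U : E → Finset (List (Fin m × Bool))} {a : E → Fin m × Bool} {E₀ : Finset E}
  {F₀ : Finset F} {q C : ℕ} {t δ ρ : ℝ}

open Classical in
theorem card_mul_pow_card_le_of_faceWord_eq (hU : IsCodebook Y.inv n a U)
    (hE : IsOrientation Y.inv E₀) (hF : IsOrientation Y.finv F₀) (hq : 0 < q)
    (hcard : ∀ e, q ^ n e ≤ q ^ C * (U e).card) (hδ : 0 ≤ δ) (hρ₀ : 0 ≤ ρ) (hρ : ρ ≤ q ^ t)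
    (hineq : ∀ Z : (Y.subdivide n hpos hinv).Sub, (t + δ) * Z.numFaces ≤ Z.numEdges)
    {T : Finset F} (hT : T ⊆ F₀) (hne : T.Nonempty) {g : F → List (Fin m × Bool)}
    {A : Finset (E → List (Fin m × Bool))} (hA : A ⊆ Fintype.piFinset U)
    (hAg : ∀ x ∈ A, ∀ f ∈ T, Y.faceWord (symmetrize Y.inv E₀ x) f = g f) :
    (A.card : ℝ) * ρ ^ T.card ≤
      q ^ ((Fintype.card E * C : ℕ) - δ : ℝ) * (Fintype.piFinset U).card := by
  refine mul_pow_le_rpow_mul (j := ((Y.subdivide n hpos hinv).faceSpan T).numEdges)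
    (by exact_mod_cast hq) (Nat.cast_nonneg _) (Nat.cast_nonneg _) ?_ hρ₀ hρ hδ hne.card_pos ?_
  · exact_mod_cast card_mul_pow_numEdges_le_of_faceWord_eq hU hE hq hcard hA hAg
  · have := hineq ((Y.subdivide n hpos hinv).faceSpan T)
    rwa [(Y.subdivide n hpos hinv).numFaces_faceSpan hF hT] at this

open Classical in
theorem sum_pow_card_relators_inter_le [Fintype F] (hU : IsCodebook Y.inv n a U)
    (hE : IsOrientation Y.inv E₀) (hF : IsOrientation Y.finv F₀) (hq : 0 < q)
    (hcard : ∀ e, q ^ n e ≤ q ^ C * (U e).card)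
    (hball : ∀ x : E → _, (∀ e, x e ∈ U e) →
      ∀ f, Y.faceWord (symmetrize Y.inv E₀ x) f ∈ relatorBall m ℓ)
    (hinj : ∀ x : E → _, (∀ e, x e ∈ U e) →
      Function.Injective (Y.faceWord (symmetrize Y.inv E₀ x)))
    (hδ : 0 ≤ δ) (hρ₀ : 0 ≤ ρ) (hρ : ρ ≤ q ^ t)
    (hineq : ∀ Z : (Y.subdivide n hpos hinv).Sub, (t + δ) * Z.numFaces ≤ Z.numEdges)
    (w : E → List (Fin m × Bool)) :
    ∑ x ∈ Fintype.piFinset U with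
        (Y.relators ℓ F₀ (symmetrize Y.inv E₀ x) ∩ Y.relators ℓ F₀ w).Nonempty,
        ρ ^ (Y.relators ℓ F₀ (symmetrize Y.inv E₀ x) ∩ Y.relators ℓ F₀ w).card ≤
      (2 * Fintype.card F : ℝ) ^ Fintype.card F * q ^ ((Fintype.card E * C : ℕ) - δ : ℝ) *
        (Fintype.piFinset U).card := by
  set Φ := Fintype.piFinset U
  let Φ' := Φ.filter fun x =>
    (Y.relators ℓ F₀ (symmetrize Y.inv E₀ x) ∩ Y.relators ℓ F₀ w).Nonempty
  let J : Finset (Finset F × (F → F)) := Finset.univ.filter fun j => j.1 ⊆ F₀ ∧ j.1.Nonempty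
  let M (j : Finset F × (F → F)) (x : E → List (Fin m × Bool)) : Prop :=
    ∀ f ∈ j.1, Y.faceWord (symmetrize Y.inv E₀ x) f = Y.faceWord w (j.2 f)
  have hJ : (J.card : ℝ) ≤ (2 * Fintype.card F : ℝ) ^ Fintype.card F := by
    have : J.card ≤ (2 * Fintype.card F) ^ Fintype.card F := by
      simpa [mul_pow] using J.card_le_univ
    exact_mod_cast this
  calc _ ≤ ∑ j ∈ J, (Φ'.filter (M j)).card * ρ ^ j.1.card := by
        refine sum_le_sum_card_filter_mul (J := J) (M := M) (fun j _ => pow_nonneg hρ₀ _)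
          fun x hx => ?_
        obtain ⟨hxU, hx⟩ := Finset.mem_filter.1 hx
        have hxU := Fintype.mem_piFinset.1 hxU
        obtain ⟨T, hT, τ, hTcard, hτ⟩ := exists_faceWord_eq_of_relators_inter (F₀ := F₀) (w' := w)
          (hball x hxU) (hinj x hxU)
        have hne : T.Nonempty := Finset.card_pos.1 (hTcard ▸ hx.card_pos)
        exact ⟨(T, τ), Finset.mem_filter.2 ⟨Finset.mem_univ _, hT, hne⟩, hτ, hTcard ▸ le_rfl⟩
    _ ≤ ∑ _ ∈ J, q ^ ((Fintype.card E * C : ℕ) - δ : ℝ) * (Φ.card : ℝ) := by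
        refine Finset.sum_le_sum fun _ hj => ?_
        obtain ⟨-, hT, hne⟩ := Finset.mem_filter.1 hj
        exact card_mul_pow_card_le_of_faceWord_eq hU hE hF hq hcard hδ hρ₀ hρ hineq hT hne
          ((Finset.filter_subset _ _).trans (Finset.filter_subset _ _))
          fun x hx => (Finset.mem_filter.1 hx).2
    _ ≤ _ := by
        rw [Finset.sum_const, nsmul_eq_mul, mul_assoc]
        gcongr

open Classical in
theorem choose_le_mul_card_filter_fillable [Fintype F] (hm : 2 ≤ m)
    (hn : ∀ e, 2 * Fintype.card E + 3 ≤ n e)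
    (hfill : (Y.subdivide n hpos hinv).Fillable (relatorBall m ℓ)) (hδ : 0 ≤ δ)
    (hineq : ∀ Z : (Y.subdivide n hpos hinv).Sub, (t + δ) * Z.numFaces ≤ Z.numEdges) {r : ℕ}
    (hr₀ : 0 < r) (hFr : 2 * Fintype.card F ≤ r) (hr : r ≤ Fintype.card (relatorBall m ℓ))
    (hbr : (Fintype.card (relatorBall m ℓ) : ℝ) / r ≤ (2 * m - 1 : ℕ) ^ t) :
    ((Fintype.card (relatorBall m ℓ)).choose r : ℝ) ≤
      (1 + 4 ^ Fintype.card F * ((2 * Fintype.card F : ℝ) ^ Fintype.card F *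
        (2 * m - 1 : ℕ) ^ ((Fintype.card E * (2 * Fintype.card E + 3) : ℕ) - δ : ℝ))) *
      ((Finset.powersetCard r Finset.univ).filter fun S : Finset (relatorBall m ℓ) =>
        (Y.subdivide n hpos hinv).Fillable (Subtype.val '' (S : Set (relatorBall m ℓ)))).card := by
  obtain ⟨D, hD⟩ := hfill
  have : Nontrivial (Fin m) := Fin.nontrivial_iff_two_le.2 hm
  obtain ⟨U, hU, hcard⟩ := exists_isCodebook Y.inv_inv hn hinv
    fun e => D.edgeLabel ⟨(e, 0), hpos e⟩
  rw [Fintype.card_fin] at hcard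
  obtain ⟨E₀, hE⟩ := exists_isOrientation Y.inv_inv Y.inv_ne
  obtain ⟨F₀, hF⟩ := exists_isOrientation Y.finv_finv Y.finv_ne
  have hq : 0 < 2 * m - 1 := by lia
  have hmem (x : E → _) (hx : ∀ e, x e ∈ U e) := hU.symmetrize_mem Y.inv_inv E₀ hx
  have hball (x : E → _) (hx : ∀ e, x e ∈ U e) :=
    faceWord_mem_relatorBall_of_isCodebook D hU (hmem x hx)
  have hinj (x : E → _) (hx : ∀ e, x e ∈ U e) :=
    faceWord_injective_of_isCodebook hU hpos (hmem x hx) hD.bdry_injective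
  have hne : (Fintype.piFinset U).Nonempty := Fintype.piFinset_nonempty.2 fun e =>
    Finset.card_pos.1 (pos_of_mul_pos_right ((pow_pos hq _).trans_le (hcard e)) (Nat.zero_le _))
  have hF₀ : F₀.card ≤ Fintype.card F := F₀.card_le_univ
  refine (choose_le_mul_card_filter_exists_subset hr₀ (by lia) hr hne
    (fun x hx => card_relators (hball x (Fintype.mem_piFinset.1 hx))
      (hinj x (Fintype.mem_piFinset.1 hx)))
    fun ψ _ => sum_pow_card_relators_inter_le hU hE hF hq hcard hball hinj hδ (by positivity) hbr
      hineq (symmetrize Y.inv E₀ ψ)).trans ?_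
  gcongr with S
  · norm_num
  · rintro ⟨x, hx, hxS⟩
    have hx := Fintype.mem_piFinset.1 hx
    exact (isWordLabeling_symmetrize hU hE hx).fillable_of_relators_subset (hball x hx) (hinj x hx)
      hF (Finset.coe_subset.2 hxS)

end FixedScale

end TwoComplex

section Density

theorem rpow_sub_le_of_abs_logb_sub_le {b r d ε : ℝ} (hb : 1 < b) (hr : 0 < r)
    (h : |Real.logb b r - d| ≤ ε) : b ^ (d - ε) ≤ r :=
  (Real.le_logb_iff_rpow_le hb hr).1 (by linarith [(abs_le.1 h).1])

theorem div_le_rpow_of_abs_logb_sub_le {b r q N d ε : ℝ} (hb : 1 < b) (hr : 0 < r) (hrb : r ≤ b)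
    (hq : 0 ≤ q) (hbq : b ≤ q ^ N) (h : |Real.logb b r - d| ≤ ε) :
    b / r ≤ q ^ (N * (1 - d + ε)) := by
  have hb₀ : 0 < b := by linarith
  have hle : b ^ (d - ε) ≤ r := rpow_sub_le_of_abs_logb_sub_le hb hr h
  have hexp : 0 ≤ 1 - d + ε := by
    have := (Real.rpow_le_rpow_left_iff hb).1 ((hle.trans hrb).trans_eq (Real.rpow_one b).symm)
    linarith
  calc b / r ≤ b / b ^ (d - ε) := by gcongr
    _ = b ^ (1 - d + ε) := by
        rw [show 1 - d + ε = 1 - (d - ε) by ring, Real.rpow_sub hb₀ 1, Real.rpow_one]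
    _ ≤ (q ^ N) ^ (1 - d + ε) := by gcongr
    _ = q ^ (N * (1 - d + ε)) := (Real.rpow_mul hq _ _).symm

theorem eventually_le_of_abs_logb_sub_le {b : ℕ → ℝ} (hb : Tendsto b atTop atTop) {d ε : ℝ}
    (hε : ε < d) (k : ℕ) :
    ∀ᶠ ℓ in atTop, ∀ r : ℕ, 0 < r → |Real.logb (b ℓ) r - d| ≤ ε → k ≤ r := by
  filter_upwards [hb.eventually_gt_atTop 1,
    ((tendsto_rpow_atTop (sub_pos.2 hε)).comp hb).eventually_ge_atTop (k : ℝ)] with ℓ hℓ hk r hr h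
  exact_mod_cast hk.trans (rpow_sub_le_of_abs_logb_sub_le hℓ (Nat.cast_pos.2 hr) h)

theorem tendsto_inv_one_add_mul_rpow {q : ℝ} (hq : 1 < q) {δ : ℕ → ℝ} (hδ : Tendsto δ atTop atTop)
    (K L C : ℝ) : Tendsto (fun ℓ => (1 + K * (L * q ^ (C - δ ℓ)))⁻¹) atTop (𝓝 1) := by
  have hpow : Tendsto (fun ℓ => q ^ (C - δ ℓ)) atTop (𝓝 0) :=
    (tendsto_rpow_atBot_of_base_gt_one q hq).comp
      (tendsto_atBot_add_const_left _ C (tendsto_neg_atTop_atBot.comp hδ))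
  simpa using (((hpow.const_mul L).const_mul K).const_add 1).inv₀ (by simp)

theorem tendsto_card_relatorBall {m : ℕ} (hm : 0 < m) :
    Tendsto (fun ℓ => (Fintype.card (relatorBall m ℓ) : ℝ)) atTop atTop := by
  refine tendsto_atTop_mono (fun ℓ => ?_) tendsto_natCast_atTop_atTop
  rw [← Set.toFinset_card, ← Set.ncard_eq_toFinset_card']
  exact_mod_cast le_ncard_relatorBall hm ℓ

theorem TwoComplex.le_one_of_mul_numFaces_le_numEdges_of_fillable {V E F : Type*} [Finite F]
    (Y : TwoComplex V E F) (f : F) {m ℓ : ℕ} (hℓ : 0 < ℓ) (hfill : Y.Fillable (relatorBall m ℓ))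
    {c : ℝ} (h : ∀ Z : Y.Sub, c * Z.numFaces * ℓ ≤ Z.numEdges) : c ≤ 1 := by
  obtain ⟨F₀, hF⟩ := exists_isOrientation Y.finv_finv Y.finv_ne
  wlog hf : f ∈ F₀ generalizing f
  · exact this (Y.finv f) ((hF f).2 hf)
  have hfaces := Y.numFaces_faceSpan hF (Finset.singleton_subset_iff.2 hf)
  rw [Finset.card_singleton, Finset.coe_singleton] at hfaces
  have hle := (h (Y.faceSpan {f})).trans
    (Nat.cast_le.2 (numEdges_faceSpan_singleton_le_of_fillable hfill f))
  rw [hfaces, Nat.cast_one, mul_one] at hle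
  exact le_of_mul_le_mul_right (hle.trans_eq (one_mul _).symm) (Nat.cast_pos.2 hℓ)

end Density

theorem mainTheorem5_general {V E F : Type*} [Finite E] [Finite F] (Y : TwoComplex V E F)
    {n : ℕ → E → ℕ} (hpos : ∀ ℓ e, 0 < n ℓ e) (hinv : ∀ ℓ e, n ℓ (Y.inv e) = n ℓ e)
    (hn : ∀ e, Tendsto (fun ℓ => n ℓ e) atTop atTop) {m : ℕ} (hm : 2 ≤ m) {d s : ℝ} (hs : 0 < s)
    {Ω : ℕ → Type*} [∀ ℓ, MeasurableSpace (Ω ℓ)] {P : ∀ ℓ, Measure (Ω ℓ)}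
    [∀ ℓ, IsProbabilityMeasure (P ℓ)] {R : ∀ ℓ, Ω ℓ → Set (relatorBall m ℓ)}
    (hR : IsRandomGroupSequence m d P R)
    (hfill : ∀ᶠ ℓ in atTop, (Y.subdivide (n ℓ) (hpos ℓ) (hinv ℓ)).Fillable (relatorBall m ℓ))
    (hineq : ∀ᶠ ℓ : ℕ in atTop, ∀ Z : (Y.subdivide (n ℓ) (hpos ℓ) (hinv ℓ)).Sub,
      (1 - d + s) * (Z.numFaces : ℝ) * (ℓ : ℝ) ≤ (Z.numEdges : ℝ)) :
    Tendsto (fun ℓ => P ℓ {ω | (Y.subdivide (n ℓ) (hpos ℓ) (hinv ℓ)).Fillable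
      (Subtype.val '' R ℓ ω)}) atTop (𝓝 1) := by
  have := Fintype.ofFinite E
  have := Fintype.ofFinite F
  have hq : (1 : ℝ) < (2 * m - 1 : ℕ) := by exact_mod_cast (by lia : 1 < 2 * m - 1)
  have hδ : Tendsto (fun ℓ : ℕ => s / 2 * ℓ + -2 * (1 - d + s / 2)) atTop atTop :=
    tendsto_atTop_add_const_right _ _
      (tendsto_natCast_atTop_atTop.const_mul_atTop (half_pos hs))
  have hcard := tendsto_card_relatorBall (m := m) (by lia)
  have hr : ∀ᶠ ℓ in atTop, ∀ r : ℕ, 0 < r →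
      |Real.logb (Fintype.card (relatorBall m ℓ)) r - d| ≤ s / 2 → 2 * Fintype.card F ≤ r := by
    rcases isEmpty_or_nonempty F with hF | ⟨⟨f⟩⟩
    · simp
    · obtain ⟨ℓ, hfill, hineq, hℓ⟩ := (hfill.and (hineq.and (eventually_gt_atTop 0))).exists
      have := TwoComplex.le_one_of_mul_numFaces_le_numEdges_of_fillable _ f hℓ hfill hineq
      exact eventually_le_of_abs_logb_sub_le hcard (by linarith) _
  refine hR.densable.tendsto_measure_mem (𝒜 := fun ℓ =>
    {S | (Y.subdivide (n ℓ) (hpos ℓ) (hinv ℓ)).Fillable (Subtype.val '' S)})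
    hR.permInvariant (half_pos hs)
    (tendsto_inv_one_add_mul_rpow hq hδ (4 ^ Fintype.card F)
      ((2 * Fintype.card F : ℝ) ^ Fintype.card F)
      (Fintype.card E * (2 * Fintype.card E + 3) : ℕ)) ?_
  filter_upwards [hfill, hineq, hδ.eventually_ge_atTop 0, hr, hcard.eventually_gt_atTop 1,
    eventually_all.2 fun e => (hn e).eventually_ge_atTop (2 * Fintype.card E + 3)]
    with ℓ hfill hineq hδ hr hcard hn r hr₀ hrb hrd
  rw [inv_mul_le_iff₀ (by positivity)]
  refine TwoComplex.choose_le_mul_card_filter_fillable (t := (ℓ + 2) * (1 - d + s / 2)) hm hn hfill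
    hδ (fun Z => (hineq Z).trans' (le_of_eq (by ring))) hr₀ (hr r hr₀ hrd) hrb
    (div_le_rpow_of_abs_logb_sub_le hcard (Nat.cast_pos.2 hr₀) (Nat.cast_le.2 hrb)
      (Nat.cast_nonneg _) ?_ hrd)
  have hball := ncard_relatorBall_le hm ℓ
  rw [Set.ncard_eq_toFinset_card', Set.toFinset_card] at hball
  exact_mod_cast hball

theorem GeometricForm.tendsto_max_one_floor {V E F : Type*} (Y : GeometricForm V E F) (e : E) :
    Tendsto (fun ℓ : ℕ => max 1 ⌊Y.len e * ℓ⌋₊) atTop atTop :=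
  tendsto_atTop_mono (fun _ => le_max_right _ _) (tendsto_nat_floor_atTop.comp
    (tendsto_natCast_atTop_atTop.const_mul_atTop (Y.len_pos e)))

theorem mainTheorem5 {V E F : Type*} (Y : GeometricForm V E F) (m : ℕ) (hm : 2 ≤ m) (d s : ℝ)
    (hs : 0 < s) {Ω : ℕ → Type*} [∀ ℓ, MeasurableSpace (Ω ℓ)] (P : ∀ ℓ, Measure (Ω ℓ))
    [∀ ℓ, IsProbabilityMeasure (P ℓ)] (R : ∀ ℓ, Ω ℓ → Set (relatorBall m ℓ))
    (hR : IsRandomGroupSequence m d P R)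
    (hfill : ∀ᶠ ℓ in atTop, (Y.scaled ℓ).Fillable (relatorBall m ℓ))
    (hineq : ∀ᶠ ℓ in atTop, ∀ Z : (Y.scaled ℓ).Sub,
      (1 - d + s) * (Z.numFaces : ℝ) * (ℓ : ℝ) ≤ (Z.numEdges : ℝ)) :
    Tendsto (fun ℓ => P ℓ {ω | (Y.scaled ℓ).Fillable (Subtype.val '' R ℓ ω)}) atTop (𝓝 1) := by
  have := Y.finite_edges
  have := Y.finite_faces
  exact mainTheorem5_general Y.toTwoComplex _ _ Y.tendsto_max_one_floor hm hs hR hfill hineq
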